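/- Let $0\le k\le n$. For $w\in S_n$ put $\sigma_k(w)=\{w(1),\dots,w(k)\}$. Let $\leq$ be the Bruhat order on $S_n$, with cover relation $\lessdot$. Write $x\lessdot_k y$ if $x\lessdot y$ and $\sigma_k(x)\neq\sigma_k(y)$; the $k$-Bruhat order $\leq_k$ is the reflexive transitive closure of $\lessdot_k$. Fix $u\leq_k w$, let $[u,w]=\{v: u\le v\le w\}$ be the Bruhat interval and $[u,w]_k=\{v : u\leq_k v\leq_k w\}$ the $k$-Bruhat interval. Let $\sigma_k(\Delta([u,w]))$ be the simplicial complex whose faces are the images $\{\sigma_k(v): v\in C\}$ of the chains $C$ of $[u,w]$. Then $C\mapsto \sigma_k(C)$ is a bijection from the maximal chains of $[u,w]_k$ to the facets of $\sigma_k(\Delta([u,w]))$. Label an edge $x\lessdot_k x\,(i\;j)$, $i\leq k<j$, of a maximal chain $u=v_0\lessdot_k v_1\lessdot_k\cdots\lessdot_k v_r=w$ by the transposition $(i\;j)$, and order these transpositions totally by: $(i\;j)<(i'\;j')$ if $w(i)>w(i')$, and $(i\;j)<(i\;j')$ if $w(j)<w(j')$. Let $<_{\mathrm{lex}}$ be the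 order on the facets of $\sigma_k(\Delta([u,w]))$ obtained by comparing lexicographically the label sequences, read from bottom to top, of the corresponding maximal chains. Then $<_{\mathrm{lex}}$ is a shelling order: it is a strict total order on the facets, all facets have the same dimension $d-1$, and for each facet $F$ other than the first, the complex $F\cap\bigcup_{F'<_{\mathrm{lex}}F}F'$ (whose faces, among which is the empty one, are the subsets of $F$ contained in some earlier facet) is pure of dimension $d-2$. In particular $\sigma_k(\Delta([u,w]))$ is shellable. -/

import Mathlib

namespace KBruhat

/-! ### Simplicial complexes and shellings -/

/-- The order complex of the set `s`, partially ordered by the relation `r`: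
its faces are the (nonempty, finite) chains of `s`. -/
def orderComplex {α : Type*} (r : α → α → Prop) (s : Set α) : PreAbstractSimplicialComplex α where
  faces := {c | c.Nonempty ∧ (c : Set α) ⊆ s ∧ IsChain r (c : Set α)}
  isRelLowerSet_faces := fun {_} hc =>
    ⟨hc.1, fun _ htc ht =>
      ⟨ht, fun _ hx => hc.2.1 (htc hx), hc.2.2.mono (Finset.coe_subset.mpr htc)⟩⟩

/-- The facets (inclusion-maximal faces) of a simplicial complex. -/
def facets {ι : Type*} (K : PreAbstractSimplicialComplex ι) : Set (Finset ι) :=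
  {F | Maximal (fun S => S ∈ K.faces) F}

/-- `lt` is a shelling order on the facets of `K`: there are finitely many facets, `lt` is a strict
total order on them, they all have the same number `d` of vertices (dimension `d - 1`), and for each
facet `F` the complex `F ∩ ⋃ F'`, the union being over the facets `F'` before `F`, is pure of
dimension `d - 2`, i.e. each of its maximal faces has `d - 1` vertices.
In this last clause the empty set counts as a face, so that a facet disjoint from
all earlier ones (if there are any) is allowed only when `d = 1`;
for the first facet there is nothing to check. -/
structure IsShellingOrder {ι : Type*} (K : PreAbstractSimplicialComplex ι)
    (lt : Finset ι → Finset ι → Prop) : Prop where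
  finite : (facets K).Finite
  total : IsStrictTotalOrder (facets K) (fun F G => lt F.1 G.1)
  pure : ∃ d : ℕ, (∀ F ∈ facets K, F.card = d) ∧
    ∀ F ∈ facets K, ∀ G : Finset ι,
      Maximal (fun S : Finset ι => S ⊆ F ∧ ∃ F' ∈ facets K, lt F' F ∧ S ⊆ F') G →
        G.card + 1 = d

/-- A simplicial complex is shellable if its facets can be put into a shelling order. -/
def IsShellable {ι : Type*} (K : PreAbstractSimplicialComplex ι) : Prop :=
  ∃ lt : Finset ι → Finset ι → Prop, IsShellingOrder K lt

/-! ### Bruhat order and `k`-Bruhat order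

Permutations of `{1, …, n}` are modelled by `Equiv.Perm (Fin n)`; the positions `1, …, k` are the
`i : Fin n` with `(i : ℕ) < k`. -/

/-- The length of a permutation: the number of its inversions. -/
def length {n : ℕ} (w : Equiv.Perm (Fin n)) : ℕ :=
  (Finset.univ.filter (fun p : Fin n × Fin n => p.1 < p.2 ∧ w p.2 < w p.1)).card

/-- The (strong) Bruhat order: the reflexive transitive closure of
`u → u (a b)` whenever `ℓ(u) < ℓ(u (a b))`. -/
def BruhatLE {n : ℕ} : Equiv.Perm (Fin n) → Equiv.Perm (Fin n) → Prop :=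
  Relation.ReflTransGen (fun u v => ∃ a b : Fin n, v = u * Equiv.swap a b ∧ length u < length v)

/-- `v` covers `u` in Bruhat order. -/
def BruhatCover {n : ℕ} (u v : Equiv.Perm (Fin n)) : Prop :=
  BruhatLE u v ∧ u ≠ v ∧ ∀ x, BruhatLE u x → BruhatLE x v → x = u ∨ x = v

/-- The interval `[u, w]` in Bruhat order. -/
def interval {n : ℕ} (u w : Equiv.Perm (Fin n)) : Set (Equiv.Perm (Fin n)) :=
  {v | BruhatLE u v ∧ BruhatLE v w}

/-- `σ_k(w) = {w(1), …, w(k)}`. -/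
def sigma {n : ℕ} (k : ℕ) (w : Equiv.Perm (Fin n)) : Finset (Fin n) :=
  (Finset.univ.filter (fun i : Fin n => (i : ℕ) < k)).image w

/-- `v` `k`-covers `u`. -/
def KCover {n : ℕ} (k : ℕ) (u v : Equiv.Perm (Fin n)) : Prop :=
  BruhatCover u v ∧ sigma k u ≠ sigma k v

/-- The `k`-Bruhat order. -/
def KBruhatLE {n : ℕ} (k : ℕ) : Equiv.Perm (Fin n) → Equiv.Perm (Fin n) → Prop :=
  Relation.ReflTransGen (KCover k)

/-- The complex `σ_k(Δ([u, w]))`: the image under `σ_k` of the order complex of `[u, w]`. -/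
def sigmaComplex {n : ℕ} (k : ℕ) (u w : Equiv.Perm (Fin n)) :
    PreAbstractSimplicialComplex (Finset (Fin n)) :=
  (orderComplex BruhatLE (interval u w)).map (sigma k)

/-! ### The lexicographic order -/

/-- The maximal chains `u = v₀ ⋖ₖ v₁ ⋖ₖ ⋯ ⋖ₖ vᵣ = w` of the `k`-Bruhat interval `[u, w]ₖ`,
listed from bottom to top. -/
def maxKChains {n : ℕ} (k : ℕ) (u w : Equiv.Perm (Fin n)) : Set (List (Equiv.Perm (Fin n))) :=
  {c | c.IsChain (KCover k) ∧ c.head? = some u ∧ c.getLast? = some w}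

/-- The image of a chain under `σ_k`. -/
def chainImage {n : ℕ} (k : ℕ) (c : List (Equiv.Perm (Fin n))) : Finset (Finset (Fin n)) :=
  c.toFinset.image (sigma k)

/-- The reflection sequence of a chain: the edge `x ⋖ x (i j)` has the label
`(i j) = x⁻¹ (x (i j))`. -/
def reflections {n : ℕ} (c : List (Equiv.Perm (Fin n))) : List (Equiv.Perm (Fin n)) :=
  List.zipWith (fun x y => x⁻¹ * y) c c.tail

/-- The order on the transpositions `(i j)` with `i ≤ k < j` that is determined by `w`:
`(i j) < (i' j')` if `w(i) > w(i')`, and `(i j) < (i j')` if `w(j) < w(j')`. -/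
def ReflLT {n : ℕ} (k : ℕ) (w s t : Equiv.Perm (Fin n)) : Prop :=
  ∃ i j i' j' : Fin n, (i : ℕ) < k ∧ k ≤ (j : ℕ) ∧ (i' : ℕ) < k ∧ k ≤ (j' : ℕ) ∧
    s = Equiv.swap i j ∧ t = Equiv.swap i' j' ∧ (w i' < w i ∨ (i = i' ∧ w j < w j'))

/-- The order on facets of `σ_k(Δ([u, w]))` that is induced by the lexicographic order of
the reflection sequences of the corresponding maximal chains of `[u, w]ₖ`. -/
def LexLT {n : ℕ} (k : ℕ) (u w : Equiv.Perm (Fin n)) (F G : Finset (Finset (Fin n))) : Prop :=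
  ∃ c ∈ maxKChains k u w, ∃ d ∈ maxKChains k u w, chainImage k c = F ∧ chainImage k d = G ∧
    List.Lex (ReflLT k w) (reflections c) (reflections d)

end KBruhat

/-!
The projection of a maximal chain of `[u, w]ₖ` has `ℓ(w) - ℓ(u) + 1` elements, since the sum of the
projection increases strictly at each `k`-cover. So these projections are exactly the facets once
the projection of every Bruhat chain of `[u, w]` is known to be contained in one of them
(`exists_maxKChain`). A `k`-cover of a given permutation is determined by its projection, which
makes the correspondence injective.

The two blocks of positions are those below `k` and the rest. Going up in the `k`-Bruhat order,
inversions inside a block can disappear but never appear. Hence an adjacent transposition `s` inside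
a block with `w s < w` lowers all of `[u, w]ₖ`, and the lifting property allows replacing `(u, w)`
by `(u s, w s)`: this reduces the containment to the case of a Grassmannian `w` (increasing on each
block). Below such a `w` the Bruhat order and the `k`-Bruhat order coincide
(`KBruhatLE.of_bruhatLE_of_grassmannian`), and a Bruhat chain can be straightened from the bottom,
replacing its elements by `k`-Bruhat larger ones with the same projection
(`BruhatLE.exists_kBruhatLE`). Translating back gives a criterion for general `w`: a Bruhat relation
`x ≤ w` is a `k`-Bruhat relation if the inversions of `w` inside the blocks are inversions of `x`
(`KBruhatLE.of_bruhatLE`).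

For the shelling, let the chain `d` precede `c`, and follow `c` from the element `u` where the two
separate. As long as the labels of `c` increase, its projections are not met by `d`: this is a
counting argument on the first `k` positions (`IncreasingFrom.sigma_ne`), based on the fact that two
positions of one block with the same relative order at both ends of an interval have that order
throughout it (`KBruhatLE.apply_lt_apply_of_ends`). As `c` and `d` share their last element, `c` has
a descent `x ⋖ₖ y ⋖ₖ z` before it meets `d` again. There `x` has another `k`-cover `v` with a
smaller label such that `v ≤ z` in Bruhat order and `v ≤ₖ w` (`exists_smaller_step`). In general `v` is not
`k`-Bruhat below `z`, but `exists_maxKChain` on `[v, w]` turns `v` and the part of `c` from `z` on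
into the end of an earlier chain, whose projection contains that of `c` except for the projection
of `y` (`exists_exchange`).
-/

namespace KBruhat

open Equiv

variable {n : ℕ}

/-! ### Lengths and covers -/

/-- A double sum, split according to which indices lie in `{a, b}`. -/
lemma sum_sum_split (f : Fin n → Fin n → ℕ) {a b : Fin n} (hab : a ≠ b) :
    ∑ p, ∑ q, f p q = (f a a + f a b + f b a + f b b) +
      ∑ c ∈ (Finset.univ.erase a).erase b, (f a c + f c a + f b c + f c b) +
      ∑ c ∈ (Finset.univ.erase a).erase b, ∑ d ∈ (Finset.univ.erase a).erase b, f c d := by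
  have key : ∀ g : Fin n → ℕ,
      ∑ p, g p = g a + g b + ∑ c ∈ (Finset.univ.erase a).erase b, g c := by
    intro g
    rw [← Finset.add_sum_erase Finset.univ g (Finset.mem_univ a),
      ← Finset.add_sum_erase (Finset.univ.erase a) g (a := b)
        (Finset.mem_erase.2 ⟨hab.symm, Finset.mem_univ b⟩)]
    ring
  simp only [key, Finset.sum_add_distrib]
  ring

lemma length_eq_sum (x : Perm (Fin n)) :
    length x = ∑ p, ∑ q, if p < q ∧ x q < x p then 1 else 0 := by
  rw [length, Finset.card_filter, ← Finset.univ_product_univ, Finset.sum_product]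

/-- Multiplying by `(a b)` creates the inversion `(a, b)` itself and two more for every position in
between whose value lies in between. -/
lemma length_mul_swap (x : Perm (Fin n)) {a b : Fin n} (hab : a < b) (hx : x a < x b) :
    length (x * swap a b) = length x + 1 +
      2 * (Finset.univ.filter fun c => a < c ∧ c < b ∧ x a < x c ∧ x c < x b).card := by
  have hne := hab.ne
  have hsub : (Finset.univ.filter fun c => a < c ∧ c < b ∧ x a < x c ∧ x c < x b) =
      ((Finset.univ.erase a).erase b).filter
        fun c => a < c ∧ c < b ∧ x a < x c ∧ x c < x b := by
    ext c; simp; grind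
  rw [length_eq_sum, length_eq_sum, sum_sum_split _ hne, sum_sum_split _ hne, hsub,
    Finset.card_filter, Finset.mul_sum]
  have h1 : ∀ c ∈ (Finset.univ.erase a).erase b, (x * swap a b) c = x c := by
    intro c hc
    simp only [Finset.mem_erase] at hc
    simp [swap_apply_of_ne_of_ne hc.2.1 hc.1]
  have ha : (x * swap a b) a = x b := by simp
  have hb : (x * swap a b) b = x a := by simp
  have h2 : ∑ c ∈ (Finset.univ.erase a).erase b, ∑ d ∈ (Finset.univ.erase a).erase b,
      (if c < d ∧ (x * swap a b) d < (x * swap a b) c then 1 else 0) =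
      ∑ c ∈ (Finset.univ.erase a).erase b, ∑ d ∈ (Finset.univ.erase a).erase b,
      (if c < d ∧ x d < x c then 1 else 0) :=
    Finset.sum_congr rfl fun c hc => Finset.sum_congr rfl fun d hd => by rw [h1 c hc, h1 d hd]
  rw [h2, ha, hb]
  have h3 : ∑ c ∈ (Finset.univ.erase a).erase b,
      ((if a < c ∧ (x * swap a b) c < x b then 1 else 0) +
        (if c < a ∧ x b < (x * swap a b) c then 1 else 0) +
        (if b < c ∧ (x * swap a b) c < x a then 1 else 0) +
        (if c < b ∧ x a < (x * swap a b) c then 1 else 0)) =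
      ∑ c ∈ (Finset.univ.erase a).erase b,
      ((if a < c ∧ x c < x a then 1 else 0) +
        (if c < a ∧ x a < x c then 1 else 0) +
        (if b < c ∧ x c < x b then 1 else 0) +
        (if c < b ∧ x b < x c then 1 else 0)) +
      ∑ c ∈ (Finset.univ.erase a).erase b,
        2 * (if a < c ∧ c < b ∧ x a < x c ∧ x c < x b then 1 else 0) := by
    rw [← Finset.sum_add_distrib]
    refine Finset.sum_congr rfl fun c hc => ?_
    rw [h1 c hc]
    simp only [Finset.mem_erase] at hc
    have e1 : x c ≠ x a := fun h => hc.2.1 (x.injective h)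
    have e2 : x c ≠ x b := fun h => hc.1 (x.injective h)
    have e3 := hc.1
    have e4 := hc.2.1
    rcases lt_or_gt_of_ne e1 with g1 | g1 <;> rcases lt_or_gt_of_ne e2 with g2 | g2 <;>
    rcases lt_or_gt_of_ne e3 with g3 | g3 <;> rcases lt_or_gt_of_ne e4 with g4 | g4 <;>
    first
      | (exfalso; order)
      | simp [g1, g2, g3, g4, not_lt_of_gt]
  rw [h3]
  simp only [hab, hx, not_lt_of_gt hab, not_lt_of_gt hx, lt_irrefl, and_self, and_false,
    false_and, if_true,
    if_false]
  ring

lemma length_lt_mul_swap (x : Perm (Fin n)) {a b : Fin n} (hab : a < b) (hx : x a < x b) :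
    length x < length (x * swap a b) := by
  rw [length_mul_swap x hab hx]; omega

lemma length_mul_swap_lt (x : Perm (Fin n)) {a b : Fin n} (hab : a < b) (hx : x b < x a) :
    length (x * swap a b) < length x := by
  have := length_lt_mul_swap (x * swap a b) hab (by simpa using hx)
  simpa using this

lemma length_mul_swap_eq_succ (x : Perm (Fin n)) {a b : Fin n} (hab : a < b) (hx : x a < x b)
    (h : ∀ c, a < c → c < b → x a < x c → x c < x b → False) :
    length (x * swap a b) = length x + 1 := by
  rw [length_mul_swap x hab hx, Finset.filter_eq_empty_iff.2]
  · simp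
  · rintro c - ⟨h1, h2, h3, h4⟩
    exact h c h1 h2 h3 h4

lemma not_between {x : Perm (Fin n)} {a b : Fin n} (hab : a < b) (hx : x a < x b)
    (h : length (x * swap a b) = length x + 1) {c : Fin n} (h1 : a < c) (h2 : c < b)
    (h3 : x a < x c) (h4 : x c < x b) : False := by
  rw [length_mul_swap x hab hx] at h
  have : (Finset.univ.filter fun c => a < c ∧ c < b ∧ x a < x c ∧ x c < x b) = ∅ := by
    rw [← Finset.card_eq_zero]; omega
  rw [Finset.filter_eq_empty_iff] at this
  exact this (Finset.mem_univ c) ⟨h1, h2, h3, h4⟩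

lemma length_inv (x : Perm (Fin n)) : length x⁻¹ = length x := by
  unfold length
  refine Finset.card_bij' (fun p _ => (x⁻¹ p.2, x⁻¹ p.1)) (fun p _ => (x p.2, x p.1))
    ?_ ?_ ?_ ?_ <;> simp +contextual

/-- A transposition that raises the length can be written so that it exchanges a non-inversion. -/
lemma exists_lt_swap {x : Perm (Fin n)} {a b : Fin n}
    (h : length x < length (x * swap a b)) :
    ∃ a' b', a' < b' ∧ x a' < x b' ∧ swap a b = swap a' b' := by
  have main : ∀ {a b : Fin n}, length x < length (x * swap a b) → a < b →
      ∃ a' b', a' < b' ∧ x a' < x b' ∧ swap a b = swap a' b' := by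
    intro a b h hab
    refine ⟨a, b, hab, ?_, rfl⟩
    by_contra hx
    have : x b ≠ x a := fun h => hab.ne' (x.injective h)
    have := length_mul_swap_lt x hab (by order)
    omega
  rcases lt_trichotomy a b with hab | hab | hab
  · exact main h hab
  · subst hab; rw [swap_self] at h; exact absurd h (lt_irrefl _)
  · rw [swap_comm] at h ⊢; exact main h hab

lemma bruhatLE_mul_swap {x : Perm (Fin n)} {a b : Fin n} (hab : a < b) (hx : x a < x b) :
    BruhatLE x (x * swap a b) :=
  .single ⟨a, b, rfl, length_lt_mul_swap x hab hx⟩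

lemma BruhatLE.trans {x y z : Perm (Fin n)} (h : BruhatLE x y) (h' : BruhatLE y z) :
    BruhatLE x z := Relation.ReflTransGen.trans h h'

lemma BruhatLE.refl (x : Perm (Fin n)) : BruhatLE x x := Relation.ReflTransGen.refl

/-- Induction on a saturated sequence of reflections, removing its first step. -/
lemma BruhatLE.head_induction {y : Perm (Fin n)} {P : Perm (Fin n) → Prop} (base : P y)
    (step : ∀ x a b, a < b → x a < x b → BruhatLE (x * swap a b) y → P (x * swap a b) → P x)
    {x : Perm (Fin n)} (h : BruhatLE x y) : P x := by
  induction h using Relation.ReflTransGen.head_induction_on with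
  | refl => exact base
  | head h1 h2 ih =>
    obtain ⟨a, b, rfl, hl⟩ := h1
    obtain ⟨a', b', h3, h4, h5⟩ := exists_lt_swap hl
    rw [h5] at h2 ih
    exact step _ a' b' h3 h4 h2 ih

lemma BruhatLE.eq_or_length_lt {x y : Perm (Fin n)} (h : BruhatLE x y) :
    x = y ∨ length x < length y := by
  refine h.head_induction (P := fun x => x = y ∨ length x < length y) (.inl rfl) ?_
  intro x a b hab hx _ ih
  have := length_lt_mul_swap x hab hx
  rcases ih with rfl | ih
  · exact .inr this
  · exact .inr (this.trans ih)

lemma BruhatLE.eq_of_length_le {x y : Perm (Fin n)} (h : BruhatLE x y)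
    (hl : length y ≤ length x) : x = y := by
  rcases h.eq_or_length_lt with h | h
  · exact h
  · omega

lemma BruhatLE.inv {x y : Perm (Fin n)} (h : BruhatLE x y) : BruhatLE x⁻¹ y⁻¹ := by
  refine h.head_induction (P := fun x => BruhatLE x⁻¹ y⁻¹) (.refl _) ?_
  intro x a b hab hx _ ih
  refine BruhatLE.trans (.single ⟨x a, x b, ?_, ?_⟩) ih
  · rw [swap_apply_apply]; simp [mul_assoc]
  · rw [length_inv, length_inv]; exact length_lt_mul_swap x hab hx

lemma swap_mul_swap_mul_swap_of_ne {a b c : Fin n} (hac : a ≠ c) (hcb : c ≠ b) (hab : a ≠ b) :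
    swap a c * swap a b * swap c b = swap a b := by
  ext i
  simp only [Perm.mul_apply, swap_apply_def]
  grind

/-- Covers in Bruhat order are the multiplications by a transposition that raise the length by
one. -/
lemma bruhatCover_iff {x y : Perm (Fin n)} :
    BruhatCover x y ↔ ∃ a b, a < b ∧ x a < x b ∧ y = x * swap a b ∧ length y = length x + 1 := by
  constructor
  · rintro ⟨hle, hne, hcov⟩
    obtain rfl | ⟨z, ⟨a, b, rfl, hl⟩, h2⟩ := Relation.ReflTransGen.cases_head hle
    · exact absurd rfl hne
    · have hy := hcov _ (.single ⟨a, b, rfl, hl⟩) h2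
      obtain rfl := hy.resolve_left (fun h => by rw [h] at hl; omega)
      obtain ⟨a', b', h3, h4, h5⟩ := exists_lt_swap hl
      rw [h5] at hcov ⊢
      refine ⟨a', b', h3, h4, rfl, length_mul_swap_eq_succ x h3 h4 fun c h6 h7 h8 h9 => ?_⟩
      -- an intermediate position `c` yields the path `p q r → q p r → r p q → r q p` through
      -- strictly increasing lengths
      have e := swap_mul_swap_mul_swap_of_ne h6.ne h7.ne h3.ne
      have s1 := length_lt_mul_swap x h6 h8
      have v1 : (x * swap a' c) a' = x c := by simp
      have v2 : (x * swap a' c) b' = x b' := by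
        simp [swap_apply_of_ne_of_ne h3.ne' h7.ne']
      have v3 : (x * swap a' c) c = x a' := by simp
      have h10 : (x * swap a' c) a' < (x * swap a' c) b' := by rw [v1, v2]; exact h9
      have s2 := length_lt_mul_swap (x * swap a' c) h3 h10
      have h11 : (x * swap a' c * swap a' b') c < (x * swap a' c * swap a' b') b' := by
        rw [Perm.mul_apply (x * swap a' c), Perm.mul_apply (x * swap a' c),
          swap_apply_of_ne_of_ne h6.ne' h7.ne, swap_apply_right, v1, v3]
        exact h8
      have s3 := length_lt_mul_swap _ h7 h11
      have t1 := bruhatLE_mul_swap h6 h8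
      have t2 := (bruhatLE_mul_swap h3 h10).trans (bruhatLE_mul_swap h7 h11)
      have t3 : x * swap a' c * swap a' b' * swap c b' = x * swap a' b' := by
        rw [mul_assoc, mul_assoc, ← mul_assoc (swap a' c), e]
      rw [t3] at t2 s3
      rcases hcov _ t1 t2 with h | h
      · rw [h] at s1; omega
      · rw [h] at s2
        rw [h] at s3
        omega
  · rintro ⟨a, b, hab, hx, rfl, hl⟩
    refine ⟨bruhatLE_mul_swap hab hx, fun h => by rw [← h] at hl; omega, fun z h1 h2 => ?_⟩
    rcases h1.eq_or_length_lt with h | h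
    · exact .inl h.symm
    · exact .inr (h2.eq_of_length_le (by omega))

lemma mem_sigma {k : ℕ} {x : Perm (Fin n)} {v : Fin n} :
    v ∈ sigma k x ↔ ((x⁻¹ v : Fin n) : ℕ) < k := by
  simp only [sigma, Finset.mem_image, Finset.mem_filter, Finset.mem_univ, true_and]
  constructor
  · rintro ⟨i, hi, rfl⟩; simpa using hi
  · intro h; exact ⟨_, h, by simp⟩

lemma apply_mem_sigma {k : ℕ} {x : Perm (Fin n)} {i : Fin n} :
    x i ∈ sigma k x ↔ (i : ℕ) < k := by
  simp [mem_sigma]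

lemma sigma_mul_swap {k : ℕ} (x : Perm (Fin n)) {a b : Fin n} (h : (a : ℕ) < k ↔ (b : ℕ) < k) :
    sigma k (x * swap a b) = sigma k x := by
  ext v
  simp only [mem_sigma, mul_inv_rev, swap_inv, Perm.mul_apply]
  generalize x⁻¹ v = c
  simp only [swap_apply_def]
  grind

/-- A `k`-cover exchanges a position below `k` with one that is not. -/
lemma kCover_iff {k : ℕ} {x y : Perm (Fin n)} :
    KCover k x y ↔ ∃ i j : Fin n, (i : ℕ) < k ∧ k ≤ (j : ℕ) ∧ x i < x j ∧ y = x * swap i j ∧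
      length y = length x + 1 := by
  rw [KCover, bruhatCover_iff]
  constructor
  · rintro ⟨⟨a, b, hab, hx, rfl, hl⟩, hs⟩
    have : ¬((a : ℕ) < k ↔ (b : ℕ) < k) := fun h => hs (sigma_mul_swap x h).symm
    have hab' : (a : ℕ) < b := hab
    exact ⟨a, b, by omega, by omega, hx, rfl, hl⟩
  · rintro ⟨i, j, hi, hj, hx, rfl, hl⟩
    refine ⟨⟨i, j, ?_, hx, rfl, hl⟩, fun h => ?_⟩
    · exact Fin.lt_def.2 (by omega)
    · have h1 : x j ∈ sigma k (x * swap i j) := by simpa [mem_sigma] using hi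
      rw [← h, apply_mem_sigma] at h1
      omega

variable {k : ℕ}

/-! ### The lifting property -/

lemma mul_swap_mul_swap (x : Perm (Fin n)) (a b p q : Fin n) :
    x * swap p q * swap a b = x * swap a b * swap (swap a b p) (swap a b q) := by
  rw [swap_apply_apply]
  simp [mul_assoc]

lemma swap_lt_swap {a b p q : Fin n} (hab : (b : ℕ) = a + 1) (hpq : p < q)
    (hne : ¬(p = a ∧ q = b)) : swap a b p < swap a b q := by
  simp only [swap_apply_def]
  have h1 : ∀ i j : Fin n, i = j ↔ (i : ℕ) = j := fun i j => Fin.ext_iff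
  simp only [h1] at hne ⊢
  rw [Fin.lt_def] at hpq ⊢
  split_ifs <;> omega

lemma bruhatLE_mul_adj_of_step {x : Perm (Fin n)} {a b p q : Fin n} (hab : (b : ℕ) = a + 1)
    (hpq : p < q) (hx : x p < x q) (hne : ¬(p = a ∧ q = b)) :
    BruhatLE (x * swap a b) (x * swap p q * swap a b) := by
  rw [mul_swap_mul_swap]
  exact bruhatLE_mul_swap (swap_lt_swap hab hpq hne) (by simpa using hx)

lemma bruhatLE_mul_adj_self {y : Perm (Fin n)} {a b : Fin n} (hab : a < b) (hy : y b < y a) :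
    BruhatLE (y * swap a b) y := by
  simpa using bruhatLE_mul_swap (x := y * swap a b) hab (by simpa using hy)

/-- The lifting property, at the upper end. -/
lemma BruhatLE.mul_adj_le {x y : Perm (Fin n)} (h : BruhatLE x y) {a b : Fin n}
    (hab : (b : ℕ) = a + 1) (hy : y b < y a) : BruhatLE (x * swap a b) y := by
  refine h.head_induction (P := fun x => BruhatLE (x * swap a b) y)
    (bruhatLE_mul_adj_self (Fin.lt_def.2 (by omega)) hy) ?_
  intro x p q hpq hx h2 ih
  by_cases hc : p = a ∧ q = b
  · obtain ⟨rfl, rfl⟩ := hc; exact h2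
  · exact (bruhatLE_mul_adj_of_step hab hpq hx hc).trans ih

/-- The lifting property, at the lower end. -/
lemma BruhatLE.le_mul_adj {x y : Perm (Fin n)} (h : BruhatLE x y) {a b : Fin n}
    (hab : (b : ℕ) = a + 1) (hx : x a < x b) : BruhatLE x (y * swap a b) := by
  have hlt : a < b := Fin.lt_def.2 (by omega)
  induction h with
  | refl => exact bruhatLE_mul_swap hlt hx
  | tail h1 h2 ih =>
    obtain ⟨p, q, rfl, hl⟩ := h2
    obtain ⟨p', q', h3, h4, h5⟩ := exists_lt_swap hl
    rw [h5]
    by_cases hc : p' = a ∧ q' = b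
    · obtain ⟨rfl, rfl⟩ := hc
      rw [mul_assoc, swap_mul_self, mul_one]
      exact h1
    · exact BruhatLE.trans ih (bruhatLE_mul_adj_of_step hab h3 h4 hc)

lemma BruhatLE.le_adj_mul {x y : Perm (Fin n)} (h : BruhatLE x y) {m m' : Fin n}
    (hm : (m' : ℕ) = m + 1) (hx : x⁻¹ m < x⁻¹ m') : BruhatLE x (swap m m' * y) := by
  simpa using (h.inv.le_mul_adj hm hx).inv

lemma length_mul_adj {x : Perm (Fin n)} {a b : Fin n} (hab : (b : ℕ) = a + 1) (hx : x a < x b) :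
    length (x * swap a b) = length x + 1 :=
  length_mul_swap_eq_succ x (Fin.lt_def.2 (by omega)) hx fun c h1 h2 _ _ => by
    rw [Fin.lt_def] at h1 h2; omega

lemma length_eq_mul_adj_add_one {x : Perm (Fin n)} {a b : Fin n} (hab : (b : ℕ) = a + 1)
    (hx : x b < x a) :
    length x = length (x * swap a b) + 1 := by
  simpa using length_mul_adj (x := x * swap a b) hab (by simpa using hx)

lemma length_adj_mul {x : Perm (Fin n)} {m m' : Fin n} (hm : (m' : ℕ) = m + 1)
    (hx : x⁻¹ m < x⁻¹ m') : length (swap m m' * x) = length x + 1 := by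
  rw [← length_inv, ← length_inv x, mul_inv_rev, swap_inv]
  exact length_mul_adj hm hx

/-- The smaller of `x` and `x (a b)` in Bruhat order, for `a < b`. -/
def lower (a b : Fin n) (x : Perm (Fin n)) : Perm (Fin n) :=
  if x b < x a then x * swap a b else x

lemma sigma_lower {a b : Fin n} (hk : (a : ℕ) < k ↔ (b : ℕ) < k) (x : Perm (Fin n)) :
    sigma k (lower a b x) = sigma k x := by
  rw [lower]; split_ifs
  · exact sigma_mul_swap x hk
  · rfl

/-- Passing to the smaller element of each coset of an adjacent transposition preserves the Bruhat
order. -/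
lemma BruhatLE.lower {x y : Perm (Fin n)} (h : BruhatLE x y) {a b : Fin n}
    (hab : (b : ℕ) = a + 1) : BruhatLE (lower a b x) (lower a b y) := by
  have hlt : a < b := Fin.lt_def.2 (by omega)
  have h1 : BruhatLE (KBruhat.lower a b x) y ∧
      KBruhat.lower a b x a < KBruhat.lower a b x b := by
    unfold KBruhat.lower
    split_ifs with hx
    · exact ⟨(bruhatLE_mul_adj_self hlt hx).trans h, by simpa using hx⟩
    · have : x a ≠ x b := fun h => hlt.ne (x.injective h)
      exact ⟨h, by order⟩
  by_cases hy : y b < y a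
  · rw [show KBruhat.lower a b y = y * swap a b from if_pos hy]
    exact h1.1.le_mul_adj hab h1.2
  · rw [show KBruhat.lower a b y = y from if_neg hy]
    exact h1.1

/-! ### The `k`-Bruhat order -/

lemma KCover.le_apply {x y : Perm (Fin n)} (h : KCover k x y) {l : Fin n} (hl : (l : ℕ) < k) :
    x l ≤ y l := by
  obtain ⟨i, j, hi, hj, hx, rfl, -⟩ := kCover_iff.1 h
  by_cases hli : l = i
  · subst hli; simpa using hx.le
  · have : l ≠ j := by rintro rfl; omega
    simp [swap_apply_of_ne_of_ne hli this]

/-- A `k`-cover creates no inversion inside a block of positions: it could do so only for a position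
between the two exchanged ones whose value lies between theirs. -/
lemma KCover.apply_lt_apply {x y : Perm (Fin n)} (h : KCover k x y) {a b : Fin n} (hab : a < b)
    (hk : (a : ℕ) < k ↔ (b : ℕ) < k) (hx : x a < x b) : y a < y b := by
  obtain ⟨i, j, hi, hj, hij, rfl, hl⟩ := kCover_iff.1 h
  have hlt : i < j := Fin.lt_def.2 (by omega)
  have key := fun c => not_between hlt hij hl (c := c)
  have inj : ∀ c d : Fin n, c ≠ d → x c ≠ x d := fun c d h h' => h (x.injective h')
  have h1 := Fin.lt_def.1 hab
  simp only [Perm.mul_apply]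
  by_cases hai : a = i
  · subst hai
    have hbj : b ≠ j := by rintro rfl; omega
    rw [swap_apply_left, swap_apply_of_ne_of_ne hab.ne' hbj]
    have h2 := key b hab (Fin.lt_def.2 (by omega)) hx
    have h3 := inj b j hbj
    order
  · by_cases hbi : b = i
    · subst hbi
      have haj : a ≠ j := by rintro rfl; omega
      rw [swap_apply_left, swap_apply_of_ne_of_ne hai haj]
      order
    · by_cases haj : a = j
      · subst haj
        rw [swap_apply_right, swap_apply_of_ne_of_ne hbi hab.ne']
        order
      · by_cases hbj : b = j
        · subst hbj
          rw [swap_apply_right, swap_apply_of_ne_of_ne hai haj]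
          have h2 := fun h => key a (Fin.lt_def.2 (by omega)) hab h hx
          have h3 := inj a i hai
          order
        · rwa [swap_apply_of_ne_of_ne hai haj, swap_apply_of_ne_of_ne hbi hbj]

lemma KBruhatLE.le_apply {x y : Perm (Fin n)} (h : KBruhatLE k x y) {l : Fin n}
    (hl : (l : ℕ) < k) : x l ≤ y l := by
  induction h with
  | refl => exact le_rfl
  | tail _ h2 ih => exact ih.trans (h2.le_apply hl)

lemma KBruhatLE.apply_lt_apply {x y : Perm (Fin n)} (h : KBruhatLE k x y) {a b : Fin n}
    (hab : a < b) (hk : (a : ℕ) < k ↔ (b : ℕ) < k) (hx : x a < x b) : y a < y b := by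
  induction h with
  | refl => exact hx
  | tail _ h2 ih => exact h2.apply_lt_apply hab hk ih

/-- Inversions inside a block of positions are inherited downwards in the `k`-Bruhat order. -/
lemma KBruhatLE.inversion {x y : Perm (Fin n)} (h : KBruhatLE k x y) {a b : Fin n}
    (hab : a < b) (hk : (a : ℕ) < k ↔ (b : ℕ) < k) (hy : y b < y a) : x b < x a := by
  have h1 : x a ≠ x b := fun h => hab.ne (x.injective h)
  have h2 := mt (h.apply_lt_apply hab hk) hy.not_gt
  order

lemma KCover.bruhatLE {x y : Perm (Fin n)} (h : KCover k x y) : BruhatLE x y := h.1.1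

lemma KCover.length_eq {x y : Perm (Fin n)} (h : KCover k x y) : length y = length x + 1 := by
  obtain ⟨i, j, hi, hj, hx, rfl, hl⟩ := kCover_iff.1 h
  exact hl

lemma KBruhatLE.bruhatLE {x y : Perm (Fin n)} (h : KBruhatLE k x y) : BruhatLE x y := by
  induction h with
  | refl => exact .refl _
  | tail _ h2 ih => exact ih.trans h2.bruhatLE

lemma swap_lt_iff {a b : Fin n} (hk : (a : ℕ) < k ↔ (b : ℕ) < k) (i : Fin n) :
    ((swap a b i : Fin n) : ℕ) < k ↔ (i : ℕ) < k := by
  simp only [swap_apply_def]; split_ifs <;> simp_all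

/-- Right multiplication by an adjacent transposition `(a b)` inside a block preserves `k`-covers,
if both ends are raised by it or both are lowered. -/
lemma KCover.mul_adj {x y : Perm (Fin n)} (h : KCover k x y) {a b : Fin n}
    (hab : (b : ℕ) = a + 1) (hk : (a : ℕ) < k ↔ (b : ℕ) < k) (hxy : x a < x b ∨ y b < y a) :
    KCover k (x * swap a b) (y * swap a b) := by
  have hlt : a < b := Fin.lt_def.2 (by omega)
  have hl : length (y * swap a b) = length (x * swap a b) + 1 := by
    have h0 := h.length_eq
    rcases hxy with hx | hy
    · rw [length_mul_adj hab hx, length_mul_adj hab (h.apply_lt_apply hlt hk hx), h0]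
    · have e1 := length_eq_mul_adj_add_one hab hy
      have e2 := length_eq_mul_adj_add_one hab (KBruhatLE.inversion (.single h) hlt hk hy)
      omega
  obtain ⟨i, j, hi, hj, hij, rfl, -⟩ := kCover_iff.1 h
  refine kCover_iff.2 ⟨swap a b i, swap a b j, (swap_lt_iff hk i).2 hi, ?_, by simpa using hij,
    mul_swap_mul_swap .., hl⟩
  have := swap_lt_iff hk j
  omega

lemma KBruhatLE.mul_adj {x y : Perm (Fin n)} (h : KBruhatLE k x y) {a b : Fin n}
    (hab : (b : ℕ) = a + 1) (hk : (a : ℕ) < k ↔ (b : ℕ) < k) (hxy : x a < x b ∨ y b < y a) :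
    KBruhatLE k (x * swap a b) (y * swap a b) := by
  have hlt : a < b := Fin.lt_def.2 (by omega)
  induction h using Relation.ReflTransGen.head_induction_on with
  | refl => exact .refl
  | head h1 h2 ih =>
    refine .head (h1.mul_adj hab hk ?_) (ih ?_)
    · exact hxy.imp_right fun h => KBruhatLE.inversion h2 hlt hk h
    · exact hxy.imp_left fun h => h1.apply_lt_apply hlt hk h

/-- Left multiplication by an adjacent transposition that raises both ends of a `k`-Bruhat
interval preserves the `k`-Bruhat relation, provided it `k`-covers the upper end. -/
lemma KBruhatLE.adj_mul {x y : Perm (Fin n)} (h : KBruhatLE k x y) {m m' : Fin n}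
    (hm : (m' : ℕ) = m + 1) (hx : x⁻¹ m < x⁻¹ m') (hy : KCover k y (swap m m' * y)) :
    KBruhatLE k (swap m m' * x) (swap m m' * y) := by
  induction h using Relation.ReflTransGen.head_induction_on with
  | refl => exact .refl
  | @head x z h1 h2 ih =>
    have hlx := length_adj_mul hm hx
    by_cases hz : z⁻¹ m < z⁻¹ m'
    · refine .head ?_ (ih hz)
      have hlz := length_adj_mul hm hz
      obtain ⟨i, j, hi, hj, hij, rfl, hl⟩ := kCover_iff.1 h1
      refine kCover_iff.2 ⟨i, j, hi, hj, ?_, by rw [mul_assoc], by omega⟩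
      have h3 := Fin.lt_def.1 hij
      have h4 : ¬(x i = m ∧ x j = m') := by
        rintro ⟨h5, h6⟩
        apply hz.not_gt
        rw [← h5, ← h6]
        simpa using Fin.lt_def.2 (by omega : (i : ℕ) < j)
      exact swap_lt_swap hm hij h4
    · -- here `z` itself is the product of the adjacent transposition and `x`
      have hlt : m < m' := Fin.lt_def.2 (by omega)
      have h3 : z⁻¹ m ≠ z⁻¹ m' := fun h => hlt.ne (z⁻¹.injective h)
      have h4 : BruhatLE (x⁻¹ * swap m m') z⁻¹ :=
        h1.bruhatLE.inv.mul_adj_le hm (by order)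
      have h5 : BruhatLE (swap m m' * x) z := by simpa using h4.inv
      have h6 := h5.eq_of_length_le (by rw [h1.length_eq, hlx])
      rw [h6]
      exact .tail h2 hy

/-- A permutation without descents inside the blocks is increasing on each block. -/
lemma apply_lt_apply_of_adj {w : Perm (Fin n)}
    (h : ∀ a b : Fin n, (b : ℕ) = a + 1 → ((a : ℕ) < k ↔ (b : ℕ) < k) → w a ≤ w b)
    {a b : Fin n} (hab : a < b) (hk : (a : ℕ) < k ↔ (b : ℕ) < k) : w a < w b := by
  obtain ⟨d, hd⟩ : ∃ d : ℕ, (b : ℕ) = a + 1 + d :=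
    ⟨b - a - 1, by have := Fin.lt_def.1 hab; omega⟩
  replace h : ∀ a b : Fin n, (b : ℕ) = a + 1 → ((a : ℕ) < k ↔ (b : ℕ) < k) → w a < w b := by
    intro a b hab hk
    refine lt_of_le_of_ne (h a b hab hk) fun he => ?_
    rw [w.injective he] at hab
    omega
  induction d generalizing b with
  | zero => exact h a b hd hk
  | succ d ih =>
    have hlt : (b : ℕ) - 1 < n := by omega
    refine (ih (b := ⟨(b : ℕ) - 1, hlt⟩) ?_ ?_ ?_).trans (h _ _ ?_ ?_)
    · exact Fin.lt_def.2 (by simp; omega)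
    · simp; omega
    · simp; omega
    · simp; omega
    · simp; omega

/-- Below a Grassmannian permutation `w`, that is, one increasing on both blocks of positions, the
Bruhat order and the `k`-Bruhat order agree. The induction removes a left descent of `w`: its two
values occur in different blocks, so that the result is Grassmannian again and `k`-covered by
`w`. -/
lemma KBruhatLE.of_bruhatLE_of_grassmannian {w : Perm (Fin n)}
    (hw : ∀ a b : Fin n, a < b → ((a : ℕ) < k ↔ (b : ℕ) < k) → w a < w b)
    {x : Perm (Fin n)} (h : BruhatLE x w) : KBruhatLE k x w := by
  induction hL : length w using Nat.strong_induction_on generalizing w x with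
  | _ L IH =>
  subst hL
  by_cases hex : ∃ m m' : Fin n, (m' : ℕ) = m + 1 ∧ w⁻¹ m' < w⁻¹ m
  · obtain ⟨m, m', hm, hlt⟩ := hex
    have hmm : m < m' := Fin.lt_def.2 (by omega)
    set w₀ := swap m m' * w with hw₀
    have hww : w = swap m m' * w₀ := by simp [hw₀]
    have hw₀lt : w₀⁻¹ m < w₀⁻¹ m' := by simpa [hw₀] using hlt
    have hlen : length w = length w₀ + 1 := by rw [hww]; exact length_adj_mul hm hw₀lt
    have hblock : ¬(((w⁻¹ m' : Fin n) : ℕ) < k ↔ ((w⁻¹ m : Fin n) : ℕ) < k) := fun hb => by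
      have := hw _ _ hlt hb
      simp at this
      order
    have hlt' := Fin.lt_def.1 hlt
    have hcov : KCover k w₀ w := by
      refine kCover_iff.2 ⟨w⁻¹ m', w⁻¹ m, by omega, by omega, by simpa [hw₀] using hmm, ?_, hlen⟩
      have := swap_apply_apply w⁻¹ m' m
      rw [this, hw₀, swap_comm m m']
      simp [mul_assoc]
    have hg : ∀ a b : Fin n, a < b → ((a : ℕ) < k ↔ (b : ℕ) < k) → w₀ a < w₀ b := by
      intro a b hab hk
      refine swap_lt_swap hm (hw a b hab hk) ?_
      rintro ⟨h1, h2⟩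
      apply hblock
      rw [← h1, ← h2]
      simpa using hk.symm
    by_cases hx : x⁻¹ m < x⁻¹ m'
    · exact .tail (IH _ (by omega) hg (h.le_adj_mul hm hx) rfl) hcov
    · have hne : x⁻¹ m ≠ x⁻¹ m' := fun h => hmm.ne (x⁻¹.injective h)
      have hx' : x⁻¹ m' < x⁻¹ m := by order
      set x₀ := swap m m' * x with hx₀
      have hxx : x = swap m m' * x₀ := by simp [hx₀]
      have hx₀lt : x₀⁻¹ m < x₀⁻¹ m' := by simpa [hx₀] using hx'
      have h1 : BruhatLE x₀ x := by
        have := (bruhatLE_mul_adj_self (y := x⁻¹) hmm hx').inv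
        simpa using this
      have h2 : KBruhatLE k x₀ w₀ := IH _ (by omega) hg ((h1.trans h).le_adj_mul hm hx₀lt) rfl
      have h3 := h2.adj_mul hm hx₀lt (by rw [← hww]; exact hcov)
      rwa [← hww, ← hxx] at h3
  · push Not at hex
    have hmono : ∀ a b : Fin n, a < b → w⁻¹ a < w⁻¹ b := fun a b hab =>
      apply_lt_apply_of_adj (k := n) (fun a b hab _ => hex a b hab) hab (by simp)
    have h0 : length w = 0 := by
      rw [length, Finset.card_eq_zero, Finset.filter_eq_empty_iff]
      rintro ⟨p, q⟩ - ⟨h1, h2⟩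
      have := hmono _ _ h2
      simp at this
      order
    rw [h.eq_of_length_le (by omega)]
    exact .refl

/-- A relation `x ≤ w` of the Bruhat order belongs to the `k`-Bruhat order as soon as every
inversion of `w` within one of the two blocks of positions is an inversion of `x`. -/
lemma KBruhatLE.of_bruhatLE {x w : Perm (Fin n)} (h : BruhatLE x w)
    (hinv : ∀ a b : Fin n, a < b → ((a : ℕ) < k ↔ (b : ℕ) < k) → w b < w a → x b < x a) :
    KBruhatLE k x w := by
  induction hL : length w using Nat.strong_induction_on generalizing w x with
  | _ L IH =>
  subst hL
  by_cases hex : ∃ a b : Fin n, (b : ℕ) = a + 1 ∧ ((a : ℕ) < k ↔ (b : ℕ) < k) ∧ w b < w a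
  · obtain ⟨a, b, hab, hk, hw⟩ := hex
    have hlt : a < b := Fin.lt_def.2 (by omega)
    have hx := hinv a b hlt hk hw
    have h1 : BruhatLE (x * swap a b) (w * swap a b) := by
      have := h.lower hab
      rwa [lower, lower, if_pos hx, if_pos hw] at this
    have h2 : KBruhatLE k (x * swap a b) (w * swap a b) := by
      refine IH _ ?_ h1 ?_ rfl
      · have := length_eq_mul_adj_add_one hab hw; omega
      · intro p q hpq hpk hwpq
        refine hinv _ _ (swap_lt_swap hab hpq ?_) ?_ hwpq
        · rintro ⟨rfl, rfl⟩
          simp only [Perm.mul_apply, swap_apply_left, swap_apply_right] at hwpq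
          order
        · rw [swap_lt_iff hk, swap_lt_iff hk, hpk]
    have h3 := h2.mul_adj hab hk (.inl (by simpa using hx))
    simpa using h3
  · push Not at hex
    refine .of_bruhatLE_of_grassmannian (fun a b hab hk => apply_lt_apply_of_adj hex hab hk) h

/-- Below `y`, every lower bound `x` of `y` is `k`-Bruhat below some element with the same
projection as `y`. -/
lemma BruhatLE.exists_kBruhatLE {x y : Perm (Fin n)} (k : ℕ) (h : BruhatLE x y) :
    ∃ z, KBruhatLE k x z ∧ BruhatLE z y ∧ sigma k z = sigma k y := by
  induction hL : length y using Nat.strong_induction_on generalizing x y with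
  | _ L IH =>
  subst hL
  by_cases hex : ∃ a b : Fin n, (b : ℕ) = a + 1 ∧ ((a : ℕ) < k ↔ (b : ℕ) < k) ∧ y b < y a
  · obtain ⟨a, b, hab, hk, hy⟩ := hex
    have hlt : a < b := Fin.lt_def.2 (by omega)
    have hlen := length_eq_mul_adj_add_one hab hy
    have hys := bruhatLE_mul_adj_self hlt hy
    by_cases hx : x a < x b
    · obtain ⟨z, h1, h2, h3⟩ := IH _ (by omega) (h.le_mul_adj hab hx) rfl
      exact ⟨z, h1, h2.trans hys, h3.trans (sigma_mul_swap y hk)⟩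
    · have hne : x a ≠ x b := fun h => hlt.ne (x.injective h)
      have hx' : x b < x a := by order
      have h1 : BruhatLE (x * swap a b) (y * swap a b) := by
        have := h.lower hab
        rwa [KBruhat.lower, KBruhat.lower, if_pos hx', if_pos hy] at this
      obtain ⟨z, h2, h3, h4⟩ := IH _ (by omega) h1 rfl
      refine ⟨z * swap a b, ?_, (h3.trans hys).mul_adj_le hab hy, ?_⟩
      · have := h2.mul_adj hab hk (.inl (by simpa using hx'))
        simpa using this
      · rw [sigma_mul_swap z hk, h4, sigma_mul_swap y hk]
  · push Not at hex
    refine ⟨y, .of_bruhatLE_of_grassmannian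
      (fun a b hab hk => apply_lt_apply_of_adj hex hab hk) h, .refl _, rfl⟩

/-! ### Maximal chains -/

lemma singleton_mem_maxKChains (w : Perm (Fin n)) : [w] ∈ maxKChains k w w := by
  simp [maxKChains]

lemma cons_mem_maxKChains {u v w : Perm (Fin n)} {c : List (Perm (Fin n))} (h : KCover k u v)
    (hc : c ∈ maxKChains k v w) : u :: c ∈ maxKChains k u w := by
  obtain ⟨h1, h2, h3⟩ := hc
  cases c with
  | nil => simp at h2
  | cons a c =>
    simp only [List.head?_cons, Option.some.injEq] at h2
    subst h2
    exact ⟨List.isChain_cons_cons.2 ⟨h, h1⟩, rfl, by simpa using h3⟩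

lemma maxKChains_cases {u w : Perm (Fin n)} {c : List (Perm (Fin n))}
    (hc : c ∈ maxKChains k u w) : (u = w ∧ c = [u]) ∨
      ∃ v c', c = u :: v :: c' ∧ KCover k u v ∧ v :: c' ∈ maxKChains k v w := by
  obtain ⟨h1, h2, h3⟩ := hc
  match c with
  | [] => simp at h2
  | [a] =>
    simp only [List.head?_cons, Option.some.injEq, List.getLast?_singleton] at h2 h3
    exact .inl ⟨h2.symm.trans h3, by rw [h2]⟩
  | a :: b :: c =>
    simp only [List.head?_cons, Option.some.injEq] at h2
    subst h2
    rw [List.isChain_cons_cons] at h1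
    exact .inr ⟨b, c, rfl, h1.1, h1.2, rfl, by simpa using h3⟩

/-- Induction on maximal chains with a fixed upper end, from their shorter upper parts. -/
lemma maxKChains_induction {w : Perm (Fin n)} {P : Perm (Fin n) → List (Perm (Fin n)) → Prop}
    (base : P w [w])
    (step : ∀ u v c, KCover k u v → v :: c ∈ maxKChains k v w → P v (v :: c) → P u (u :: v :: c))
    {u : Perm (Fin n)} {c : List (Perm (Fin n))} (hc : c ∈ maxKChains k u w) : P u c := by
  induction c generalizing u with
  | nil => simp [maxKChains] at hc
  | cons a c ih =>
    rcases maxKChains_cases hc with ⟨rfl, h⟩ | ⟨v, c', h1, h2, h3⟩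
    · rw [h]; exact base
    · obtain ⟨rfl, rfl⟩ := List.cons_eq_cons.1 h1
      exact step _ _ _ h2 h3 (ih h3)

lemma chainImage_cons (x : Perm (Fin n)) (c : List (Perm (Fin n))) :
    chainImage k (x :: c) = insert (sigma k x) (chainImage k c) := by
  simp [chainImage]

lemma mem_chainImage {c : List (Perm (Fin n))} {S : Finset (Fin n)} :
    S ∈ chainImage k c ↔ ∃ v ∈ c, sigma k v = S := by
  simp [chainImage]

lemma maxKChains_append {u v w : Perm (Fin n)} (h : KBruhatLE k u v) {c : List (Perm (Fin n))}
    (hc : c ∈ maxKChains k v w) : ∃ c' ∈ maxKChains k u w, chainImage k c ⊆ chainImage k c' := by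
  induction h using Relation.ReflTransGen.head_induction_on with
  | refl => exact ⟨c, hc, subset_rfl⟩
  | head h1 _ ih =>
    obtain ⟨c', h2, h3⟩ := ih
    exact ⟨_, cons_mem_maxKChains h1 h2,
      h3.trans (by rw [chainImage_cons]; exact Finset.subset_insert _ _)⟩

lemma sigma_head_mem {u w : Perm (Fin n)} {c : List (Perm (Fin n))} (hc : c ∈ maxKChains k u w) :
    sigma k u ∈ chainImage k c := by
  rcases maxKChains_cases hc with ⟨rfl, rfl⟩ | ⟨v, c', rfl, -, -⟩ <;> simp [chainImage]

lemma maxKChains_mul_adj {u w : Perm (Fin n)} {a b : Fin n} (hab : (b : ℕ) = a + 1)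
    (hk : (a : ℕ) < k ↔ (b : ℕ) < k) (hu : u a < u b) {c : List (Perm (Fin n))}
    (hc : c ∈ maxKChains k u w) :
    ∃ c' ∈ maxKChains k (u * swap a b) (w * swap a b), chainImage k c' = chainImage k c := by
  have hlt : a < b := Fin.lt_def.2 (by omega)
  revert hu
  refine maxKChains_induction (P := fun u c => u a < u b →
    ∃ c' ∈ maxKChains k (u * swap a b) (w * swap a b), chainImage k c' = chainImage k c) ?_ ?_ hc
  · intro _
    exact ⟨_, singleton_mem_maxKChains _, by simp [chainImage, sigma_mul_swap w hk]⟩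
  · intro u v c h1 _ ih hu
    obtain ⟨c', h2, h3⟩ := ih (h1.apply_lt_apply hlt hk hu)
    exact ⟨_, cons_mem_maxKChains (h1.mul_adj hab hk (.inl hu)) h2, by
      rw [chainImage_cons, chainImage_cons u, h3, sigma_mul_swap u hk]⟩

lemma exists_maxKChain_of_grassmannian {u w : Perm (Fin n)}
    (hw : ∀ a b : Fin n, a < b → ((a : ℕ) < k ↔ (b : ℕ) < k) → w a < w b)
    (h : KBruhatLE k u w) {C : Finset (Perm (Fin n))} (hC : ↑C ⊆ interval u w)
    (hch : IsChain BruhatLE (C : Set (Perm (Fin n)))) :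
    ∃ c ∈ maxKChains k u w, ∀ v ∈ C, sigma k v ∈ chainImage k c := by
  induction hN : C.card using Nat.strong_induction_on generalizing u C with
  | _ N IH =>
  subst hN
  rcases C.eq_empty_or_nonempty with rfl | hne
  · obtain ⟨c, hc, -⟩ := maxKChains_append h (singleton_mem_maxKChains w)
    exact ⟨c, hc, by simp⟩
  · -- the lowest element `v` is replaced by some `z ≤ v` with the same projection that is
    -- `k`-Bruhat above `u`
    obtain ⟨v, hv, hmin⟩ := C.exists_min_image length hne
    obtain ⟨h1, h2⟩ := hC hv
    obtain ⟨z, h3, h4, h5⟩ := h1.exists_kBruhatLE k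
    have hz : KBruhatLE k z w := .of_bruhatLE_of_grassmannian hw (h4.trans h2)
    have hC' : ↑(C.erase v) ⊆ interval z w := by
      intro y hy
      rw [Finset.mem_coe, Finset.mem_erase] at hy
      refine ⟨h4.trans ?_, (hC hy.2).2⟩
      rcases hch hv hy.2 hy.1.symm with h | h
      · exact h
      · exact absurd (h.eq_of_length_le (hmin y hy.2)) hy.1
    obtain ⟨c, hc, hcC⟩ := IH _ (Finset.card_erase_lt_of_mem hv) hz hC'
      (hch.mono (by simp)) rfl
    obtain ⟨c', hc', hsub⟩ := maxKChains_append h3 hc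
    refine ⟨c', hc', fun y hy => hsub ?_⟩
    by_cases hyv : y = v
    · rw [hyv, ← h5]; exact sigma_head_mem hc
    · exact hcC y (Finset.mem_erase.2 ⟨hyv, hy⟩)

/-- The projection of a Bruhat chain of `[u, w]` is contained in the projection of a maximal chain
of the `k`-Bruhat interval `[u, w]ₖ`. A descent of `w` inside a block is also one of `u`, and
`lower` removes it from both without affecting projections; so `w` may be taken Grassmannian. -/
lemma exists_maxKChain {u w : Perm (Fin n)}
    (h : KBruhatLE k u w) {C : Finset (Perm (Fin n))} (hC : ↑C ⊆ interval u w)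
    (hch : IsChain BruhatLE (C : Set (Perm (Fin n)))) :
    ∃ c ∈ maxKChains k u w, ∀ v ∈ C, sigma k v ∈ chainImage k c := by
  induction hL : length w using Nat.strong_induction_on generalizing u w C with
  | _ L IH =>
  subst hL
  by_cases hex : ∃ a b : Fin n, (b : ℕ) = a + 1 ∧ ((a : ℕ) < k ↔ (b : ℕ) < k) ∧ w b < w a
  · obtain ⟨a, b, hab, hk, hw⟩ := hex
    have hlt : a < b := Fin.lt_def.2 (by omega)
    have hu := h.inversion hlt hk hw
    have hlw : lower a b w = w * swap a b := if_pos hw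
    have hlu : lower a b u = u * swap a b := if_pos hu
    obtain ⟨c, hc, hcC⟩ := IH _ (by have := length_eq_mul_adj_add_one hab hw; omega)
      (h.mul_adj hab hk (.inr hw)) (C := C.image (lower a b)) (by
        intro y hy
        rw [Finset.mem_coe, Finset.mem_image] at hy
        obtain ⟨v, hv, rfl⟩ := hy
        rw [← hlw, ← hlu]
        exact ⟨(hC hv).1.lower hab, (hC hv).2.lower hab⟩) (by
        intro y hy z hz hyz
        rw [Finset.mem_coe, Finset.mem_image] at hy hz
        obtain ⟨y, hy, rfl⟩ := hy
        obtain ⟨z, hz, rfl⟩ := hz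
        exact (hch hy hz fun h => hyz (by rw [h])).imp (·.lower hab) (·.lower hab)) rfl
    obtain ⟨c', hc', he⟩ := maxKChains_mul_adj hab hk (by simpa using hu) hc
    refine ⟨c', by simpa using hc', fun v hv => ?_⟩
    rw [he, ← sigma_lower hk]
    exact hcC _ (Finset.mem_image_of_mem _ hv)
  · push Not at hex
    refine exists_maxKChain_of_grassmannian
      (fun a b hab hk => apply_lt_apply_of_adj hex hab hk) h hC hch

/-! ### Labels and exchanges in maximal chains -/

lemma swap_eq_swap {i j i' j' : Fin n} (hi : (i : ℕ) < k) (hj : k ≤ (j : ℕ))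
    (hi' : (i' : ℕ) < k) (hj' : k ≤ (j' : ℕ)) (h : swap i j = swap i' j') : i = i' ∧ j = j' := by
  have h1 := congrArg (fun f => f i) h
  have h2 : i ≠ j' := by rintro rfl; omega
  have h3 : i ≠ j := by rintro rfl; omega
  simp only [swap_apply_left] at h1
  by_cases h4 : i = i'
  · subst h4; simpa using h1
  · rw [swap_apply_of_ne_of_ne h4 h2] at h1
    exact absurd h1.symm h3

/-- On transpositions written with their smaller position first, `ReflLT` is the order given by the
positions: the representation `(i j)` with `i ≤ k < j` is unique. -/
lemma reflLT_swap_iff {w : Perm (Fin n)} {i j i' j' : Fin n} (hi : (i : ℕ) < k)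
    (hj : k ≤ (j : ℕ)) (hi' : (i' : ℕ) < k) (hj' : k ≤ (j' : ℕ)) :
    ReflLT k w (swap i j) (swap i' j') ↔ w i' < w i ∨ (i = i' ∧ w j < w j') := by
  constructor
  · rintro ⟨p, q, p', q', h1, h2, h3, h4, h5, h6, h7⟩
    obtain ⟨rfl, rfl⟩ := swap_eq_swap hi hj h1 h2 h5
    obtain ⟨rfl, rfl⟩ := swap_eq_swap hi' hj' h3 h4 h6
    exact h7
  · intro h
    exact ⟨i, j, i', j', hi, hj, hi', hj', rfl, rfl, h⟩

/-- Two positions of one block whose values are in the same relative order at the two ends of a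
`k`-Bruhat interval are in that order throughout the interval. -/
lemma KBruhatLE.apply_lt_apply_of_ends {x y w : Perm (Fin n)} (h : KBruhatLE k x y)
    (h' : KBruhatLE k y w) {a b : Fin n} (hk : (a : ℕ) < k ↔ (b : ℕ) < k) (hx : x a < x b)
    (hw : w a < w b) : y a < y b := by
  rcases lt_trichotomy a b with hab | rfl | hab
  · exact h.apply_lt_apply hab hk hx
  · exact absurd hx (lt_irrefl _)
  · by_contra hy
    have hne : y a ≠ y b := fun h => hab.ne' (y.injective h)
    have := h'.apply_lt_apply hab hk.symm (by order)
    order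

lemma KBruhatLE.head {x y z : Perm (Fin n)} (h : KCover k x y) (h' : KBruhatLE k y z) :
    KBruhatLE k x z := Relation.ReflTransGen.head h h'

lemma kCover_of_between {x v z : Perm (Fin n)} {i j : Fin n} (hi : (i : ℕ) < k) (hj : k ≤ (j : ℕ))
    (hv : v = x * swap i j) (hx : x i < x j) (hvz : length v < length z)
    (hz : length z = length x + 1 + 1) : KCover k x v := by
  refine kCover_iff.2 ⟨i, j, hi, hj, hx, hv, ?_⟩
  have := length_lt_mul_swap x (Fin.lt_def.2 (by omega : (i : ℕ) < j)) hx
  rw [← hv] at this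
  omega

/-- A descent `(i j) > (i' j')` of the label sequence at `y`, between `x` and `z`, can be replaced
by a step from `x` with a smaller label, to an element that is still below `z` and `k`-Bruhat below
`w`. The new element need not be `k`-Bruhat below `z`. -/
lemma exists_smaller_step {x z w : Perm (Fin n)} {i j i' j' : Fin n} (hi : (i : ℕ) < k)
    (hj : k ≤ (j : ℕ)) (hi' : (i' : ℕ) < k) (hj' : k ≤ (j' : ℕ))
    (hxy : KCover k x (x * swap i j)) (hyz : KCover k (x * swap i j) z)
    (hz : z = x * swap i j * swap i' j')
    (h1 : x i < x j) (h2 : (x * swap i j) i' < (x * swap i j) j')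
    (hzw : KBruhatLE k z w) (hlab : w i < w i' ∨ (i' = i ∧ w j' < w j)) :
    ∃ p q : Fin n, (p : ℕ) < k ∧ k ≤ (q : ℕ) ∧ KCover k x (x * swap p q) ∧
      BruhatLE (x * swap p q) z ∧ KBruhatLE k (x * swap p q) w ∧
      (w i < w p ∨ (p = i ∧ w q < w j)) := by
  have hlz : length z = length x + 1 + 1 := by rw [hyz.length_eq, hxy.length_eq]
  have hij : i ≠ j := by rintro rfl; omega
  have hij' : i ≠ j' := by rintro rfl; omega
  have hi'j : i' ≠ j := by rintro rfl; omega
  have hi'j' : i' ≠ j' := by rintro rfl; omega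
  simp only [Perm.mul_apply] at h2
  by_cases hii : i' = i
  · subst hii
    have hwj : w j' < w j := by
      rcases hlab with h | h
      · exact absurd h (lt_irrefl _)
      · exact h.2
    have hjj : j ≠ j' := by rintro rfl; order
    rw [swap_apply_left, swap_apply_of_ne_of_ne hij'.symm hjj.symm] at h2
    have zi : z i' = x j' := by
      rw [hz, Perm.mul_apply, Perm.mul_apply, swap_apply_left,
        swap_apply_of_ne_of_ne hij'.symm hjj.symm]
    have zj : z j = x i' := by
      rw [hz, Perm.mul_apply, Perm.mul_apply, swap_apply_of_ne_of_ne hij.symm hjj,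
        swap_apply_right]
    have zj' : z j' = x j := by
      rw [hz, Perm.mul_apply, Perm.mul_apply, swap_apply_right, swap_apply_left]
    have hlt : j' < j := by
      rcases lt_or_gt_of_ne hjj with h | h
      · have := hzw.apply_lt_apply h (by omega) (by rw [zj, zj']; exact h1)
        order
      · exact h
    set v := x * swap i' j' with hv
    have vi : v i' = x j' := by simp [hv]
    have vj' : v j' = x i' := by simp [hv]
    have vj : v j = x j := by simp [hv, swap_apply_of_ne_of_ne hij.symm hjj]
    have hvc : ∀ c, c ≠ i' → c ≠ j' → v c = x c := by
      intro c h3 h4; simp [hv, swap_apply_of_ne_of_ne h3 h4]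
    have hzc : ∀ c, c ≠ i' → c ≠ j' → c ≠ j → z c = x c := by
      intro c h3 h4 h5
      rw [hz, Perm.mul_apply, Perm.mul_apply, swap_apply_of_ne_of_ne h3 h4,
        swap_apply_of_ne_of_ne h3 h5]
    have hzv : z = v * swap j' j := by
      ext l
      by_cases a1 : l = i'
      · subst a1
        rw [zi, Perm.mul_apply, swap_apply_of_ne_of_ne hi'j' hi'j, vi]
      · by_cases a2 : l = j'
        · subst a2; rw [zj', Perm.mul_apply, swap_apply_left, vj]
        · by_cases a3 : l = j
          · subst a3; rw [zj, Perm.mul_apply, swap_apply_right, vj']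
          · rw [hzc l a1 a2 a3, Perm.mul_apply, swap_apply_of_ne_of_ne a2 a3, hvc l a1 a2]
    have hvlt : v j' < v j := by rw [vj', vj]; exact h1
    have hvz : BruhatLE v z := by rw [hzv]; exact bruhatLE_mul_swap hlt hvlt
    have hxv : KCover k x v := kCover_of_between hi hj' hv (h1.trans h2)
      (by rw [hzv]; exact length_lt_mul_swap v hlt hvlt) hlz
    refine ⟨i', j', hi, hj', hxv, hvz, .of_bruhatLE (hvz.trans hzw.bruhatLE) ?_,
      .inr ⟨rfl, hwj⟩⟩
    -- inversions of `w` inside a block are inversions of both `x` and `z`; they are inversions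
    -- of `v`, since neither `x ⋖ x (i' j)` nor `z ≤ₖ w` leaves room for a position `b` past `j'`
    -- with `x i' < x b < x j`
    intro a b hab hk hw
    have ix := (KBruhatLE.head hxy (.head hyz hzw)).inversion hab hk hw
    have iz := hzw.inversion hab hk hw
    have inj : ∀ c d : Fin n, c ≠ d → x c ≠ x d := fun c d h h' => h (x.injective h')
    by_cases hblk : (a : ℕ) < k
    · -- on the first block `v` and `z` agree
      have hb := hk.1 hblk
      have e : ∀ c : Fin n, (c : ℕ) < k → v c = z c := by
        intro c hc
        have a2 : c ≠ j' := by rintro rfl; omega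
        have a3 : c ≠ j := by rintro rfl; omega
        by_cases a1 : c = i'
        · rw [a1, vi, zi]
        · rw [hvc c a1 a2, hzc c a1 a2 a3]
      rw [e a hblk, e b hb]
      exact iz
    · have hbk : k ≤ (b : ℕ) := by omega
      have ha1 : a ≠ i' := by rintro rfl; omega
      have hb1 : b ≠ i' := by rintro rfl; omega
      by_cases hb2 : b = j'
      · subst hb2
        rw [vj', hvc a ha1 hab.ne]
        order
      · by_cases ha2 : a = j'
        · subst ha2
          rw [vj', hvc b hb1 hb2]
          have hbj : b ≠ j := by rintro rfl; order
          rw [zj', hzc b hb1 hb2 hbj] at iz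
          have hne := inj b i' hb1
          by_contra hcon
          have hlt2 : x i' < x b := by order
          rcases lt_or_gt_of_ne hbj with h5 | h5
          · exact not_between (Fin.lt_def.2 (by omega)) h1 hxy.length_eq
              (Fin.lt_def.2 (by omega)) h5 hlt2 iz
          · have := hzw.apply_lt_apply h5 (by omega)
              (by rw [zj, hzc b hb1 hb2 hbj]; exact hlt2)
            order
        · rw [hvc a ha1 ha2, hvc b hb1 hb2]
          exact ix
  · by_cases hjj : j' = j
    · subst hjj
      have hwi : w i < w i' := by
        rcases hlab with h | h
        · exact h
        · exact absurd h.1 hii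
      rw [swap_apply_of_ne_of_ne hii hi'j, swap_apply_right] at h2
      have zi : z i = x j' := by
        rw [hz, Perm.mul_apply, Perm.mul_apply, swap_apply_of_ne_of_ne (Ne.symm hii) hij,
          swap_apply_left]
      have zi' : z i' = x i := by
        rw [hz, Perm.mul_apply, Perm.mul_apply, swap_apply_left, swap_apply_right]
      have zj : z j' = x i' := by
        rw [hz, Perm.mul_apply, Perm.mul_apply, swap_apply_right, swap_apply_of_ne_of_ne hii hi'j]
      have hlt : i < i' := by
        rcases lt_or_gt_of_ne hii with h | h
        · have := hzw.apply_lt_apply h (by omega) (by rw [zi, zi']; exact h1)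
          order
        · exact h
      set v := x * swap i' j' with hv
      have vi : v i = x i := by simp [hv, swap_apply_of_ne_of_ne (Ne.symm hii) hij]
      have vi' : v i' = x j' := by simp [hv]
      have vj : v j' = x i' := by simp [hv]
      have hvc : ∀ c, c ≠ i' → c ≠ j' → v c = x c := by
        intro c h3 h4; simp [hv, swap_apply_of_ne_of_ne h3 h4]
      have hzc : ∀ c, c ≠ i → c ≠ i' → c ≠ j' → z c = x c := by
        intro c h3 h4 h5
        rw [hz, Perm.mul_apply, Perm.mul_apply, swap_apply_of_ne_of_ne h4 h5,
          swap_apply_of_ne_of_ne h3 h5]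
      have hzv : z = v * swap i i' := by
        ext l
        by_cases a1 : l = i'
        · subst a1; rw [zi', Perm.mul_apply, swap_apply_right, vi]
        · by_cases a2 : l = i
          · subst a2; rw [zi, Perm.mul_apply, swap_apply_left, vi']
          · by_cases a3 : l = j'
            · subst a3
              rw [zj, Perm.mul_apply, swap_apply_of_ne_of_ne hij.symm hi'j.symm, vj]
            · rw [hzc l a2 a1 a3, Perm.mul_apply, swap_apply_of_ne_of_ne a2 a1, hvc l a1 a3]
      have hvlt : v i < v i' := by rw [vi, vi']; exact h1
      have hvz : BruhatLE v z := by rw [hzv]; exact bruhatLE_mul_swap hlt hvlt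
      have hxv : KCover k x v := kCover_of_between hi' hj' hv (h2.trans h1)
        (by rw [hzv]; exact length_lt_mul_swap v hlt hvlt) hlz
      refine ⟨i', j', hi', hj', hxv, hvz, .of_bruhatLE (hvz.trans hzw.bruhatLE) ?_, .inl hwi⟩
      intro a b hab hk hw
      have ix := (KBruhatLE.head hxy (.head hyz hzw)).inversion hab hk hw
      have iz := hzw.inversion hab hk hw
      have inj : ∀ c d : Fin n, c ≠ d → x c ≠ x d := fun c d h h' => h (x.injective h')
      by_cases hblk : (a : ℕ) < k
      · have hb := hk.1 hblk
        have ha3 : a ≠ j' := by rintro rfl; omega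
        have hb3 : b ≠ j' := by rintro rfl; omega
        by_cases ha2 : a = i'
        · subst ha2
          rw [vi', hvc b hab.ne' hb3]
          order
        · by_cases hb2 : b = i'
          · subst hb2
            rw [vi', hvc a ha2 ha3]
            have hai : a ≠ i := by rintro rfl; order
            rw [zi', hzc a hai ha2 ha3] at iz
            have hne := inj a j' ha3
            by_contra hcon
            have hlt2 : x a < x j' := by order
            rcases lt_or_gt_of_ne hai with h5 | h5
            · have := hzw.apply_lt_apply h5 (by omega)
                (by rw [zi, hzc a hai ha2 ha3]; exact hlt2)
              order
            · exact not_between (Fin.lt_def.2 (by omega)) h1 hxy.length_eq h5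
                (Fin.lt_def.2 (by omega)) iz hlt2
          · rw [hvc a ha2 ha3, hvc b hb2 hb3]
            exact ix
      · -- on the second block `v` and `z` agree
        have e : ∀ c : Fin n, k ≤ (c : ℕ) → v c = z c := by
          intro c hc
          have a1 : c ≠ i := by rintro rfl; omega
          have a2 : c ≠ i' := by rintro rfl; omega
          by_cases a3 : c = j'
          · rw [a3, vj, zj]
          · rw [hvc c a2 a3, hzc c a1 a2 a3]
        rw [e a (by omega), e b (by omega)]
        exact iz
    · -- the two transpositions commute
      rw [swap_apply_of_ne_of_ne hii hi'j, swap_apply_of_ne_of_ne hij'.symm hjj] at h2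
      have hzv : z = x * swap i' j' * swap i j := by
        rw [hz, mul_swap_mul_swap, swap_apply_of_ne_of_ne (Ne.symm hii) hij',
          swap_apply_of_ne_of_ne hi'j.symm (Ne.symm hjj)]
      have hvlt : (x * swap i' j') i < (x * swap i' j') j := by
        rw [Perm.mul_apply, Perm.mul_apply, swap_apply_of_ne_of_ne (Ne.symm hii) hij',
          swap_apply_of_ne_of_ne hi'j.symm (Ne.symm hjj)]
        exact h1
      have hlt : i < j := Fin.lt_def.2 (by omega)
      have hlen : length (x * swap i' j') < length z := by
        rw [hzv]; exact length_lt_mul_swap _ hlt hvlt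
      have hxv : KCover k x (x * swap i' j') := kCover_of_between hi' hj' rfl h2 hlen hlz
      have hvz : KCover k (x * swap i' j') z :=
        kCover_iff.2 ⟨i, j, hi, hj, hvlt, hzv, by rw [hlz, hxv.length_eq]⟩
      refine ⟨i', j', hi', hj', hxv, hvz.bruhatLE, .head hvz hzw, .inl ?_⟩
      rcases hlab with h | h
      · exact h
      · exact absurd h.1 hii

/-! ### Increasing chains come first -/

lemma exists_apply_eq_of_mem_sigma {x : Perm (Fin n)} {V : Fin n} (h : V ∈ sigma k x) :
    ∃ a : Fin n, (a : ℕ) < k ∧ x a = V := by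
  simpa [sigma] using h

lemma card_filter_sigma (x : Perm (Fin n)) (V : Fin n) :
    (Finset.univ.filter fun l : Fin n => (l : ℕ) < k ∧ x l < V).card =
      ((sigma k x).filter (· < V)).card := by
  rw [sigma, Finset.filter_image, Finset.card_image_of_injective _ x.injective,
    Finset.filter_filter]

/-- A counting argument: a set of positions caught between `{l | y' l < V}` and `{l | y l < V}` is
equal to both if `y` and `y'` have the same projection. -/
lemma apply_lt_of_sigma_eq {y y' : Perm (Fin n)} (hs : sigma k y' = sigma k y) {V : Fin n}
    {p : Fin n → Prop} (h1 : ∀ l : Fin n, (l : ℕ) < k → y' l < V → p l)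
    (h2 : ∀ l : Fin n, (l : ℕ) < k → p l → y l < V) {l : Fin n} (hl : (l : ℕ) < k) (hp : p l) :
    y' l < V := by
  have hsub : (Finset.univ.filter fun l : Fin n => (l : ℕ) < k ∧ y' l < V) ⊆
      Finset.univ.filter fun l : Fin n => (l : ℕ) < k ∧ y l < V := by
    intro l hl
    simp only [Finset.mem_filter, Finset.mem_univ, true_and] at hl ⊢
    exact ⟨hl.1, h2 l hl.1 (h1 l hl.1 hl.2)⟩
  have heq := Finset.eq_of_subset_of_card_le hsub
    (by rw [card_filter_sigma, card_filter_sigma, hs])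
  have : l ∈ Finset.univ.filter fun l : Fin n => (l : ℕ) < k ∧ y l < V := by
    simp [hl, h2 l hl hp]
  rw [← heq] at this
  simp only [Finset.mem_filter, Finset.mem_univ, true_and] at this
  exact this.2

/-- What is known about the end `y` of a chain of `[u, w]ₖ` with increasing labels that starts at
`u` with the label `(i j)`. -/
structure IncreasingFrom (k : ℕ) (u w y : Perm (Fin n)) (i j : Fin n) : Prop where
  /-- Positions that precede `i` in the order of labels are untouched. -/
  fixed : ∀ l : Fin n, (l : ℕ) < k → w i < w l → y l = u l
  /-- The value at `i` comes from the second block. -/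
  new : y i ∉ sigma k u
  /-- Values below that at `i` stay below it. -/
  below : ∀ l : Fin n, (l : ℕ) < k → l ≠ i → u l < y i → y l < y i
  /-- The value at `i` does not pass those of the positions preceding `j` in the order of labels. -/
  above : ∀ q : Fin n, k ≤ (q : ℕ) → w q < w j → u i < u q → y i < u q

/-- The situation in an increasing chain of `[u, w]ₖ` from `u` to `y` as long as all labels are
`(i q)` for some `q` that does not precede `j`. -/
structure OnlyMoves (k : ℕ) (u w y : Perm (Fin n)) (i j : Fin n) : Prop where
  /-- The other positions of the first block are untouched. -/
  left : ∀ l : Fin n, (l : ℕ) < k → l ≠ i → y l = u l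
  /-- The positions preceding `j` in the order of labels are untouched. -/
  right : ∀ q : Fin n, k ≤ (q : ℕ) → w q < w j → y q = u q
  /-- The value at `i` does not pass those of the positions preceding `j` in the order of labels. -/
  above : ∀ q : Fin n, k ≤ (q : ℕ) → w q < w j → u i < u q → y i < u q

lemma OnlyMoves.refl (k : ℕ) (u w : Perm (Fin n)) (i j : Fin n) : OnlyMoves k u w u i j :=
  ⟨fun _ _ _ => rfl, fun _ _ _ => rfl, fun _ _ _ h => h⟩

/-- The value at `i` cannot pass that of a position `p` of the second block preceding `j` in the
order of labels: after the exchange of `i` and `q` the value at `p` would exceed that at `q`, against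
the order of the values of `w` at these positions. -/
lemma OnlyMoves.step {u w y : Perm (Fin n)} {i j q : Fin n} (h : OnlyMoves k u w y i j)
    (hi : (i : ℕ) < k) (hq : k ≤ (q : ℕ)) (huy : KBruhatLE k u y)
    (hy : KCover k y (y * swap i q)) (hyq : y i < y q) (hw : KBruhatLE k (y * swap i q) w)
    (hjq : w j ≤ w q) :
    OnlyMoves k u w (y * swap i q) i j ∧ IncreasingFrom k u w (y * swap i q) i j := by
  have hl : ∀ l : Fin n, (l : ℕ) < k → l ≠ i → (y * swap i q) l = u l := by
    intro l hlk hli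
    have : l ≠ q := by rintro rfl; omega
    rw [Perm.mul_apply, swap_apply_of_ne_of_ne hli this, h.left l hlk hli]
  have hi' : (y * swap i q) i = y q := by simp
  have habove : ∀ p : Fin n, k ≤ (p : ℕ) → w p < w j → u i < u p → (y * swap i q) i < u p := by
    intro p hp hwp hup
    have hpq : p ≠ q := by rintro rfl; order
    have hpi : p ≠ i := by rintro rfl; omega
    have h1 := h.above p hp hwp hup
    have h2 := h.right p hp hwp
    have h3 : y p ≠ y q := fun h => hpq (y.injective h)
    rw [hi']
    by_contra hcon
    have h4 := (KBruhatLE.apply_lt_apply_of_ends (.single hy) hw (a := p) (b := q) (by omega)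
      (by order) (by order))
    rw [Perm.mul_apply, Perm.mul_apply, swap_apply_right, swap_apply_of_ne_of_ne hpi hpq] at h4
    order
  refine ⟨⟨hl, fun p hp hwp => ?_, habove⟩, ⟨fun l hlk hwl => hl l hlk ?_, fun hmem => ?_,
    fun l hlk hli hlt => ?_, habove⟩⟩
  · have hpq : p ≠ q := by rintro rfl; order
    have hpi : p ≠ i := by rintro rfl; omega
    rw [Perm.mul_apply, swap_apply_of_ne_of_ne hpi hpq, h.right p hp hwp]
  · rintro rfl; order
  · obtain ⟨a, ha, hae⟩ := exists_apply_eq_of_mem_sigma hmem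
    rw [hi'] at hae
    by_cases hai : a = i
    · subst hai
      have := huy.le_apply ha
      order
    · rw [← h.left a ha hai] at hae
      have := y.injective hae
      subst this
      omega
  · rw [hl l hlk hli]; exact hlt

lemma IncreasingFrom.step {u w y : Perm (Fin n)} {i j p q : Fin n}
    (h : IncreasingFrom k u w y i j) (hi : (i : ℕ) < k) (hp : (p : ℕ) < k) (hq : k ≤ (q : ℕ))
    (hy : KCover k y (y * swap p q)) (hw : KBruhatLE k (y * swap p q) w) (hpi : w p < w i) :
    IncreasingFrom k u w (y * swap p q) i j := by
  have hne : p ≠ i := by rintro rfl; order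
  have hiq : i ≠ q := by rintro rfl; omega
  have hyi : (y * swap p q) i = y i := by
    rw [Perm.mul_apply, swap_apply_of_ne_of_ne hne.symm hiq]
  have hl : ∀ l : Fin n, (l : ℕ) < k → l ≠ p → (y * swap p q) l = y l := by
    intro l hlk hlp
    have : l ≠ q := by rintro rfl; omega
    rw [Perm.mul_apply, swap_apply_of_ne_of_ne hlp this]
  refine ⟨fun l hlk hwl => ?_, ?_, fun l hlk hli hlt => ?_, ?_⟩
  · rw [hl l hlk (by rintro rfl; order), h.fixed l hlk hwl]
  · rw [hyi]; exact h.new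
  · rw [hyi] at hlt
    have h1 := h.below l hlk hli hlt
    by_cases hlp : l = p
    · subst hlp
      exact KBruhatLE.apply_lt_apply_of_ends (.single hy) hw (by omega) h1 hpi
    · rw [hyi, hl l hlk hlp]; exact h1
  · rw [hyi]; exact h.above

/-- A chain that starts at `u` with a smaller label than an increasing chain never meets the
projections of the latter. -/
lemma IncreasingFrom.sigma_ne {u w y y' : Perm (Fin n)} {i j p q : Fin n}
    (h : IncreasingFrom k u w y i j) (hi : (i : ℕ) < k) (hp : (p : ℕ) < k) (hq : k ≤ (q : ℕ))
    (huy : KBruhatLE k u y) (hyw : KBruhatLE k y w) (hcov : KCover k u (u * swap p q))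
    (hupq : u p < u q) (hy' : KBruhatLE k (u * swap p q) y')
    (hlab : w i < w p ∨ (p = i ∧ w q < w j)) : sigma k y' ≠ sigma k y := by
  intro hs
  have hle : ∀ l : Fin n, (l : ℕ) < k → u l ≤ y' l := fun l hl =>
    (KBruhatLE.head hcov hy').le_apply hl
  have hyp : u q ≤ y' p := by simpa using hy'.le_apply hp
  have hinj : ∀ a : Fin n, a ≠ p → u a ≠ u p := fun a h h' => h (u.injective h')
  rcases hlab with hlab | ⟨rfl, hlab⟩
  · have hpf := h.fixed p hp hlab
    have hV : u p ∈ sigma k y' := by rw [hs, ← hpf]; exact apply_mem_sigma.2 hp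
    obtain ⟨a, ha, hae⟩ := exists_apply_eq_of_mem_sigma hV
    have hap : a ≠ p := by rintro rfl; order
    have := hle a ha
    have h3 := hinj a hap
    have h4 : y' a < u p := by
      refine apply_lt_of_sigma_eq hs (p := fun l => u l < u p)
        (fun l hl h5 => (hle l hl).trans_lt h5) (fun l hl h5 => ?_) ha (by order)
      rcases lt_trichotomy (w l) (w p) with h6 | h6 | h6
      · rw [← hpf]
        exact huy.apply_lt_apply_of_ends hyw (by omega) h5 h6
      · rw [w.injective h6] at h5; order
      · rw [h.fixed l hl (by order)]; exact h5
    order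
  · have habove := h.above q hq hlab hupq
    have hV : y p ∈ sigma k y' := by rw [hs]; exact apply_mem_sigma.2 hp
    obtain ⟨a, ha, hae⟩ := exists_apply_eq_of_mem_sigma hV
    have hap : a ≠ p := by rintro rfl; order
    have h3 : u a ≠ y p := fun h' => h.new (by rw [← h']; exact apply_mem_sigma.2 ha)
    have := hle a ha
    have h4 : y' a < y p := by
      refine apply_lt_of_sigma_eq hs (p := fun l => l ≠ p ∧ u l < y p)
        (fun l hl h5 => ⟨?_, (hle l hl).trans_lt h5⟩) (fun l hl h5 => h.below l hl h5.1 h5.2) ha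
        ⟨hap, by order⟩
      rintro rfl; order
    order

/-! ### The exchange property of maximal chains -/

lemma reflections_cons {x v w : Perm (Fin n)} {e : List (Perm (Fin n))}
    (he : e ∈ maxKChains k v w) : reflections (x :: e) = x⁻¹ * v :: reflections e := by
  rcases maxKChains_cases he with ⟨rfl, rfl⟩ | ⟨v', c', rfl, -, -⟩ <;> simp [reflections]

lemma kBruhatLE_of_mem {u w v : Perm (Fin n)} {c : List (Perm (Fin n))}
    (hc : c ∈ maxKChains k u w) (hv : v ∈ c) : KBruhatLE k u v ∧ KBruhatLE k v w := by
  revert v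
  refine maxKChains_induction (P := fun u c => ∀ {v}, v ∈ c → KBruhatLE k u v ∧ KBruhatLE k v w)
    ?_ ?_ hc
  · intro v h
    rw [List.mem_singleton] at h
    subst h
    exact ⟨.refl, .refl⟩
  · intro u v' c h1 h2 ih v hv
    rcases List.mem_cons.1 hv with rfl | hv
    · refine ⟨.refl, .head h1 ?_⟩
      exact (ih List.mem_cons_self).2
    · exact ⟨.head h1 (ih hv).1, (ih hv).2⟩

lemma isChain_of_mem_maxKChains {u w : Perm (Fin n)} {c : List (Perm (Fin n))}
    (hc : c ∈ maxKChains k u w) : IsChain BruhatLE (c.toFinset : Set (Perm (Fin n))) := by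
  refine maxKChains_induction
    (P := fun u c => IsChain BruhatLE (c.toFinset : Set (Perm (Fin n)))) ?_ ?_ hc
  · simp
  · intro u v c h1 h2 ih
    rw [List.toFinset_cons, Finset.coe_insert]
    refine ih.insert fun y hy _ => .inl (h1.bruhatLE.trans ?_)
    rw [Finset.mem_coe, List.mem_toFinset] at hy
    exact (kBruhatLE_of_mem h2 hy).1.bruhatLE

lemma head_mem {u w : Perm (Fin n)} {c : List (Perm (Fin n))}
    (hc : c ∈ maxKChains k u w) : u ∈ c := by
  rcases maxKChains_cases hc with ⟨rfl, rfl⟩ | ⟨v', c', rfl, -, -⟩ <;> simp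

lemma last_mem {u w : Perm (Fin n)} {c : List (Perm (Fin n))}
    (hc : c ∈ maxKChains k u w) : w ∈ c :=
  List.mem_of_getLast? hc.2.2

/-- Follow a chain whose labels increase from `u` on, in the presence of a chain `u :: d` with a
smaller first label. It has to have a descent before it meets the projection of `u :: d` again,
and at the first descent it can be exchanged. -/
lemma exists_exchange_of_increasing {u w : Perm (Fin n)} {i j p q : Fin n} (hi : (i : ℕ) < k)
    (hp : (p : ℕ) < k) (hq : k ≤ (q : ℕ)) (hcov : KCover k u (u * swap p q)) (hupq : u p < u q)
    (hlab : w i < w p ∨ (p = i ∧ w q < w j)) {d : List (Perm (Fin n))}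
    (hd : d ∈ maxKChains k (u * swap p q) w) {y : Perm (Fin n)} {c : List (Perm (Fin n))}
    (hc : c ∈ maxKChains k y w) {x : Perm (Fin n)} {i₂ j₂ : Fin n} (hi₂ : (i₂ : ℕ) < k)
    (hj₂ : k ≤ (j₂ : ℕ)) (hxy : KCover k x y) (hy : y = x * swap i₂ j₂) (hx : x i₂ < x j₂)
    (huy : KBruhatLE k u y) (hinc : IncreasingFrom k u w y i j)
    (hphase : (i₂ = i ∧ w j ≤ w j₂ ∧ OnlyMoves k u w y i j) ∨ w i₂ < w i) :
    ∃ S ∈ chainImage k c, S ∉ chainImage k (u :: d) ∧ ∃ e ∈ maxKChains k x w,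
      List.Lex (ReflLT k w) (reflections e) (reflections (x :: c)) ∧
      (chainImage k (x :: c)).erase S ⊆ chainImage k e := by
  have hnot : ∀ {y}, KBruhatLE k u y → KBruhatLE k y w → IncreasingFrom k u w y i j →
      sigma k y ∉ chainImage k (u :: d) := by
    intro y h1 h2 h3 hmem
    rw [chainImage_cons, Finset.mem_insert] at hmem
    rcases hmem with h4 | h4
    · exact h3.new (by rw [← h4]; exact apply_mem_sigma.2 hi)
    · obtain ⟨y', h5, h6⟩ := mem_chainImage.1 h4
      exact h3.sigma_ne hi hp hq h1 h2 hcov hupq (kBruhatLE_of_mem hd h5).1 hlab h6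
  induction c generalizing x y i₂ j₂ with
  | nil => simp [maxKChains] at hc
  | cons y₀ c ih =>
    rcases maxKChains_cases hc with ⟨rfl, h⟩ | ⟨z, c', he, hyz, hzc⟩
    · refine absurd ?_ (hnot huy .refl hinc)
      rw [chainImage_cons]
      exact Finset.mem_insert_of_mem (mem_chainImage.2 ⟨_, last_mem hd, rfl⟩)
    · obtain ⟨rfl, rfl⟩ := List.cons_eq_cons.1 he
      have hzw := (kBruhatLE_of_mem hzc (head_mem hzc)).2
      have hrefl : reflections (x :: y₀ :: z :: c') =
          x⁻¹ * y₀ :: reflections (y₀ :: z :: c') := reflections_cons hc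
      obtain ⟨i₃, j₃, hi₃, hj₃, hy₃, hz, -⟩ := kCover_iff.1 hyz
      have hne : ¬(i₃ = i₂ ∧ j₃ = j₂) := by
        rintro ⟨rfl, rfl⟩
        rw [hy] at hy₃
        simp only [Perm.mul_apply, swap_apply_left, swap_apply_right] at hy₃
        order
      by_cases hdes : w i₂ < w i₃ ∨ (i₃ = i₂ ∧ w j₃ < w j₂)
      · -- the labels descend at `y₀`
        subst hy
        obtain ⟨a, b, ha, hb, hxv, hvz, hvw, hab⟩ :=
          exists_smaller_step hi₂ hj₂ hi₃ hj₃ hxy hyz hz hx hy₃ hzw hdes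
        obtain ⟨e, he, hsub⟩ := exists_maxKChain hvw (C := (z :: c').toFinset) (by
          intro v hv
          rw [Finset.mem_coe, List.mem_toFinset] at hv
          have := kBruhatLE_of_mem hzc hv
          exact ⟨hvz.trans this.1.bruhatLE, this.2.bruhatLE⟩) (isChain_of_mem_maxKChains hzc)
        refine ⟨_, sigma_head_mem hc, hnot huy (.head hyz hzw) hinc, x :: e,
          cons_mem_maxKChains hxv he, ?_, ?_⟩
        · rw [hrefl, reflections_cons he]
          refine .rel ?_
          rw [inv_mul_cancel_left, inv_mul_cancel_left, reflLT_swap_iff ha hb hi₂ hj₂]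
          exact hab
        · intro T hT
          rw [Finset.mem_erase, chainImage_cons, chainImage_cons, Finset.mem_insert,
            Finset.mem_insert] at hT
          rw [chainImage_cons, Finset.mem_insert]
          obtain ⟨h1, h2 | h2 | h2⟩ := hT
          · exact .inl h2
          · exact absurd h2 h1
          · obtain ⟨v, h3, rfl⟩ := mem_chainImage.1 h2
            exact .inr (hsub v (List.mem_toFinset.2 h3))
      · -- the labels ascend at `y₀`
        have hasc : w i₃ < w i₂ ∨ (i₃ = i₂ ∧ w j₂ < w j₃) := by
          push Not at hdes
          rcases hdes.1.lt_or_eq with h | h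
          · exact .inl h
          · have h1 := w.injective h
            refine .inr ⟨h1, lt_of_le_of_ne (hdes.2 h1) fun h2 => hne ⟨h1, ?_⟩⟩
            exact (w.injective h2).symm
        have hnew : IncreasingFrom k u w z i j ∧
            ((i₃ = i ∧ w j ≤ w j₃ ∧ OnlyMoves k u w z i j) ∨ w i₃ < w i) := by
          subst hz
          rcases hphase with ⟨rfl, h1, h2⟩ | h1
          · rcases hasc with h3 | ⟨rfl, h3⟩
            · exact ⟨hinc.step hi hi₃ hj₃ hyz hzw h3, .inr h3⟩
            · have := h2.step hi hj₃ huy hyz hy₃ hzw (by order)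
              exact ⟨this.2, .inl ⟨rfl, by order, this.1⟩⟩
          · have h3 : w i₃ < w i := by
              rcases hasc with h3 | ⟨rfl, -⟩ <;> order
            exact ⟨hinc.step hi hi₃ hj₃ hyz hzw h3, .inr h3⟩
        obtain ⟨S, hS, hSd, e, he, hlex, hsub⟩ :=
          ih hzc hi₃ hj₃ hyz hz hy₃ (.tail huy hyz) hnew.1 hnew.2
        refine ⟨S, by rw [chainImage_cons]; exact Finset.mem_insert_of_mem hS, hSd, x :: e,
          cons_mem_maxKChains hxy he, ?_, ?_⟩
        · rw [hrefl, reflections_cons he]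
          exact .cons hlex
        · intro T hT
          rw [Finset.mem_erase, chainImage_cons, Finset.mem_insert] at hT
          rw [chainImage_cons, Finset.mem_insert]
          exact hT.2.imp_right fun h => hsub (Finset.mem_erase.2 ⟨hT.1, h⟩)

lemma sum_sigma (x : Perm (Fin n)) : ∑ v ∈ sigma k x, (v : ℕ) =
    ∑ l ∈ Finset.univ.filter (fun l : Fin n => (l : ℕ) < k), (x l : ℕ) := by
  rw [sigma, Finset.sum_image fun _ _ _ _ h => x.injective h]

/-- Along the `k`-Bruhat order the sum of the projection increases strictly. -/
lemma sum_sigma_lt {u v y : Perm (Fin n)} (h : KCover k u v) (h' : KBruhatLE k v y) :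
    ∑ a ∈ sigma k u, (a : ℕ) < ∑ a ∈ sigma k y, (a : ℕ) := by
  rw [sum_sigma, sum_sigma]
  obtain ⟨i, j, hi, hj, hij, rfl, -⟩ := kCover_iff.1 h
  refine Finset.sum_lt_sum (fun l hl => ?_) ⟨i, by simpa using hi, ?_⟩
  · exact (KBruhatLE.head h h').le_apply (by simpa using hl)
  · have := h'.le_apply hi
    rw [Perm.mul_apply, swap_apply_left] at this
    exact Fin.lt_def.1 (hij.trans_le this)

lemma sigma_notMem_chainImage {u v w : Perm (Fin n)} (h : KCover k u v)
    {c : List (Perm (Fin n))} (hc : c ∈ maxKChains k v w) : sigma k u ∉ chainImage k c := by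
  intro hmem
  obtain ⟨y, hy, he⟩ := mem_chainImage.1 hmem
  have := sum_sigma_lt h (kBruhatLE_of_mem hc hy).1
  rw [he] at this
  exact lt_irrefl _ this

lemma not_kCover_of_mem {w v : Perm (Fin n)} (h : KCover k w v) (h' : KBruhatLE k v w) :
    False := lt_irrefl _ (sum_sigma_lt h h')

/-- If the chain `d` comes before the chain `c` then so does a chain `e` that contains, after
projection, all of `c` but one element that does not lie in the projection of `d`. -/
lemma exists_exchange {u w : Perm (Fin n)} {c d : List (Perm (Fin n))}
    (hc : c ∈ maxKChains k u w) (hd : d ∈ maxKChains k u w)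
    (hlex : List.Lex (ReflLT k w) (reflections d) (reflections c)) :
    ∃ S ∈ chainImage k c, S ∉ chainImage k d ∧ ∃ e ∈ maxKChains k u w,
      List.Lex (ReflLT k w) (reflections e) (reflections c) ∧
      (chainImage k c).erase S ⊆ chainImage k e := by
  revert d
  refine maxKChains_induction (P := fun u c => ∀ {d}, d ∈ maxKChains k u w →
    List.Lex (ReflLT k w) (reflections d) (reflections c) →
    ∃ S ∈ chainImage k c, S ∉ chainImage k d ∧ ∃ e ∈ maxKChains k u w,
      List.Lex (ReflLT k w) (reflections e) (reflections c) ∧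
      (chainImage k c).erase S ⊆ chainImage k e) ?_ ?_ hc
  · intro d _ h
    simp [reflections] at h
  · intro u v c huv hc ih d hd hlex
    have hvw := (kBruhatLE_of_mem hc (head_mem hc)).2
    rcases maxKChains_cases hd with ⟨rfl, -⟩ | ⟨v', d', rfl, huv', hd'⟩
    · exact (not_kCover_of_mem huv hvw).elim
    rw [reflections_cons hc] at hlex ⊢
    rw [reflections_cons hd'] at hlex
    rcases List.cons_lex_cons_iff.1 hlex with hlt | ⟨heq, hlex⟩
    · obtain ⟨i, j, hi, hj, hij, rfl, -⟩ := kCover_iff.1 huv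
      obtain ⟨p, q, hp, hq, hpq, rfl, -⟩ := kCover_iff.1 huv'
      rw [inv_mul_cancel_left, inv_mul_cancel_left, reflLT_swap_iff hp hq hi hj] at hlt
      have h1 := (OnlyMoves.refl k u w i j).step hi hj .refl huv hij hvw le_rfl
      obtain ⟨S, hS, hSd, e, he, hlex, hsub⟩ := exists_exchange_of_increasing hi hp hq huv' hpq
        hlt hd' hc hi hj huv rfl hij (.single huv) h1.2 (.inl ⟨rfl, le_rfl, h1.1⟩)
      rw [reflections_cons hc] at hlex
      exact ⟨S, by rw [chainImage_cons]; exact Finset.mem_insert_of_mem hS, hSd, e, he, hlex,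
        hsub⟩
    · obtain rfl := mul_left_cancel heq
      obtain ⟨S, hS, hSd, e, he, hlex, hsub⟩ := ih hd' hlex
      refine ⟨S, by rw [chainImage_cons]; exact Finset.mem_insert_of_mem hS, ?_, u :: e,
        cons_mem_maxKChains huv he, ?_, ?_⟩
      · rw [chainImage_cons, Finset.mem_insert]
        rintro (rfl | h)
        · exact sigma_notMem_chainImage huv hc hS
        · exact hSd h
      · rw [reflections_cons he]
        exact .cons hlex
      · intro T hT
        rw [Finset.mem_erase, chainImage_cons, Finset.mem_insert] at hT
        rw [chainImage_cons, Finset.mem_insert]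
        exact hT.2.imp_right fun h => hsub (Finset.mem_erase.2 ⟨hT.1, h⟩)

/-! ### Facets -/

lemma card_chainImage {u w : Perm (Fin n)} {c : List (Perm (Fin n))}
    (hc : c ∈ maxKChains k u w) : (chainImage k c).card + length u = length w + 1 := by
  refine maxKChains_induction (P := fun u c => (chainImage k c).card + length u = length w + 1)
    ?_ ?_ hc
  · simp [chainImage, add_comm]
  · intro u v c huv hc ih
    rw [chainImage_cons, Finset.card_insert_of_notMem (sigma_notMem_chainImage huv hc)]
    have := huv.length_eq
    omega

/-- A `k`-cover of `u` is determined by its projection. -/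
lemma KCover.eq_of_sigma_eq {u v v' : Perm (Fin n)} (h : KCover k u v) (h' : KCover k u v')
    (hs : sigma k v = sigma k v') : v = v' := by
  obtain ⟨i, j, hi, hj, hij, rfl, -⟩ := kCover_iff.1 h
  obtain ⟨p, q, hp, hq, hpq, rfl, -⟩ := kCover_iff.1 h'
  have h1 : u j ∈ sigma k (u * swap p q) := by rw [← hs]; simpa [mem_sigma] using hi
  have h2 : u p ∉ sigma k (u * swap i j) := by rw [hs]; simpa [mem_sigma] using hq
  simp only [mem_sigma, mul_inv_rev, swap_inv, Perm.mul_apply, Perm.coe_inv,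
    Equiv.symm_apply_apply] at h1 h2
  have hjp : j ≠ p := by rintro rfl; omega
  have hjq : j = q := by
    by_contra hne
    rw [swap_apply_of_ne_of_ne hjp hne] at h1
    omega
  have hpi : p = i := by
    by_contra hne
    rw [swap_apply_of_ne_of_ne hne hjp.symm] at h2
    omega
  rw [hjq, hpi]

lemma sum_sigma_head_le {v w : Perm (Fin n)} {c : List (Perm (Fin n))}
    (hc : c ∈ maxKChains k v w) {S : Finset (Fin n)} (hS : S ∈ chainImage k c) :
    S = sigma k v ∨ ∑ a ∈ sigma k v, (a : ℕ) < ∑ a ∈ S, (a : ℕ) := by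
  rcases maxKChains_cases hc with ⟨rfl, rfl⟩ | ⟨v', c', rfl, h, hc'⟩
  · left; simpa [chainImage] using hS
  · rw [chainImage_cons, Finset.mem_insert] at hS
    refine hS.imp_right fun hS => ?_
    obtain ⟨y, hy, rfl⟩ := mem_chainImage.1 hS
    exact sum_sigma_lt h (kBruhatLE_of_mem hc' hy).1

lemma chainImage_injOn (u w : Perm (Fin n)) :
    Set.InjOn (chainImage k) (maxKChains k u w) := by
  intro c hc
  refine maxKChains_induction (P := fun u c => ∀ ⦃d⦄, d ∈ maxKChains k u w →
    chainImage k c = chainImage k d → c = d) ?_ ?_ hc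
  · intro d hd _
    rcases maxKChains_cases hd with ⟨-, h⟩ | ⟨v, c', rfl, h1, h2⟩
    · exact h.symm
    · exact (not_kCover_of_mem h1 (kBruhatLE_of_mem h2 (head_mem h2)).2).elim
  · intro u v c huv hc ih d hd he
    rcases maxKChains_cases hd with ⟨rfl, -⟩ | ⟨v', d', rfl, huv', hd'⟩
    · exact (not_kCover_of_mem huv (kBruhatLE_of_mem hc (head_mem hc)).2).elim
    have htail : chainImage k (v :: c) = chainImage k (v' :: d') := by
      have h1 := congrArg (fun s => s.erase (sigma k u)) he
      simpa only [chainImage_cons u, Finset.erase_insert (sigma_notMem_chainImage huv hc),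
        Finset.erase_insert (sigma_notMem_chainImage huv' hd')] using h1
    -- the projections of `v` and `v'` are the smallest elements of the common image
    have hv : sigma k v = sigma k v' := by
      have h1 := sigma_head_mem hc
      have h2 := sigma_head_mem hd'
      rw [htail] at h1
      rw [← htail] at h2
      rcases sum_sigma_head_le hd' h1 with h3 | h3
      · exact h3
      · rcases sum_sigma_head_le hc h2 with h4 | h4
        · exact h4.symm
        · omega
    obtain rfl := huv.eq_of_sigma_eq huv' hv
    rw [ih hd' htail]

/-- All maximal chains of `[u, w]ₖ` have projections of the same size, and every face is contained
in one of them. -/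
lemma mem_facets_iff {u w : Perm (Fin n)} (h : KBruhatLE k u w) {F : Finset (Finset (Fin n))} :
    F ∈ facets (sigmaComplex k u w) ↔ ∃ c ∈ maxKChains k u w, chainImage k c = F := by
  have hface : ∀ c ∈ maxKChains k u w, chainImage k c ∈ (sigmaComplex k u w).faces := by
    intro c hc
    refine ⟨c.toFinset, ⟨⟨u, List.mem_toFinset.2 (head_mem hc)⟩, fun v hv => ?_,
      isChain_of_mem_maxKChains hc⟩, rfl⟩
    rw [Finset.mem_coe, List.mem_toFinset] at hv
    have := kBruhatLE_of_mem hc hv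
    exact ⟨this.1.bruhatLE, this.2.bruhatLE⟩
  have hsub : ∀ F ∈ (sigmaComplex k u w).faces, ∃ c ∈ maxKChains k u w, F ⊆ chainImage k c := by
    rintro F ⟨C, ⟨-, h1, h2⟩, rfl⟩
    obtain ⟨c, hc, hsub⟩ := exists_maxKChain h h1 h2
    refine ⟨c, hc, fun S hS => ?_⟩
    obtain ⟨v, hv, rfl⟩ := Finset.mem_image.1 hS
    exact hsub v hv
  constructor
  · rintro ⟨h1, h2⟩
    obtain ⟨c, hc, h3⟩ := hsub F h1
    exact ⟨c, hc, le_antisymm (h2 (hface c hc) h3) h3⟩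
  · rintro ⟨c, hc, rfl⟩
    refine ⟨hface c hc, fun G hG hle => ?_⟩
    obtain ⟨d, hd, h3⟩ := hsub G hG
    have h4 := card_chainImage hc
    have h5 := card_chainImage hd
    rw [Finset.eq_of_subset_of_card_le (hle.trans h3) (by omega)]
    exact h3

/-! ### The lexicographic order -/

lemma reflLT_irrefl (w s : Perm (Fin n)) : ¬ReflLT k w s s := by
  rintro ⟨i, j, i', j', hi, hj, hi', hj', rfl, h2, h3⟩
  obtain ⟨rfl, rfl⟩ := swap_eq_swap hi hj hi' hj' h2
  rcases h3 with h3 | h3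
  · exact lt_irrefl _ h3
  · exact lt_irrefl _ h3.2

lemma ReflLT.trans {w s t r : Perm (Fin n)} (h : ReflLT k w s t) (h' : ReflLT k w t r) :
    ReflLT k w s r := by
  obtain ⟨i, j, i', j', hi, hj, hi', hj', rfl, rfl, h1⟩ := h
  obtain ⟨p, q, p', q', hp, hq, hp', hq', h2, rfl, h3⟩ := h'
  obtain ⟨rfl, rfl⟩ := swap_eq_swap hi' hj' hp hq h2
  rw [reflLT_swap_iff hi hj hp' hq']
  rcases h1 with h1 | ⟨rfl, h1⟩
  · rcases h3 with h3 | ⟨rfl, h3⟩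
    · exact .inl (h3.trans h1)
    · exact .inl h1
  · rcases h3 with h3 | ⟨rfl, h3⟩
    · exact .inl h3
    · exact .inr ⟨rfl, h1.trans h3⟩

lemma lex_reflections_trichotomous {u w : Perm (Fin n)} {c d : List (Perm (Fin n))}
    (hc : c ∈ maxKChains k u w) (hd : d ∈ maxKChains k u w)
    (h : ¬List.Lex (ReflLT k w) (reflections c) (reflections d))
    (h' : ¬List.Lex (ReflLT k w) (reflections d) (reflections c)) : c = d := by
  revert d
  refine maxKChains_induction (P := fun u c => ∀ {d}, d ∈ maxKChains k u w →
    ¬List.Lex (ReflLT k w) (reflections c) (reflections d) →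
    ¬List.Lex (ReflLT k w) (reflections d) (reflections c) → c = d) ?_ ?_ hc
  · intro d hd _ _
    rcases maxKChains_cases hd with ⟨-, h⟩ | ⟨v, c', rfl, h1, h2⟩
    · exact h.symm
    · exact (not_kCover_of_mem h1 (kBruhatLE_of_mem h2 (head_mem h2)).2).elim
  · intro u v c huv hc ih d hd h1 h2
    rcases maxKChains_cases hd with ⟨rfl, -⟩ | ⟨v', d', rfl, huv', hd'⟩
    · exact (not_kCover_of_mem huv (kBruhatLE_of_mem hc (head_mem hc)).2).elim
    rw [reflections_cons hc, reflections_cons hd'] at h1 h2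
    have hvv : v = v' := by
      have e1 : ¬ReflLT k w _ _ := fun h => h1 (.rel h)
      have e2 : ¬ReflLT k w _ _ := fun h => h2 (.rel h)
      obtain ⟨i, j, hi, hj, hij, rfl, -⟩ := kCover_iff.1 huv
      obtain ⟨p, q, hp, hq, hpq, rfl, -⟩ := kCover_iff.1 huv'
      rw [inv_mul_cancel_left, inv_mul_cancel_left, reflLT_swap_iff hi hj hp hq] at e1
      rw [inv_mul_cancel_left, inv_mul_cancel_left, reflLT_swap_iff hp hq hi hj] at e2
      push Not at e1 e2
      have e3 : p = i := w.injective (le_antisymm e2.1 e1.1)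
      have e4 : j = q := w.injective (le_antisymm (e2.2 e3) (e1.2 e3.symm))
      rw [e3, e4]
    subst hvv
    rw [ih hd' (fun h => h1 (.cons h)) (fun h => h2 (.cons h))]

lemma lexLT_chainImage_iff {u w : Perm (Fin n)} {c d : List (Perm (Fin n))}
    (hc : c ∈ maxKChains k u w) (hd : d ∈ maxKChains k u w) :
    LexLT k u w (chainImage k c) (chainImage k d) ↔
      List.Lex (ReflLT k w) (reflections c) (reflections d) := by
  constructor
  · rintro ⟨c', hc', d', hd', h1, h2, h3⟩
    rwa [chainImage_injOn u w hc' hc h1, chainImage_injOn u w hd' hd h2] at h3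
  · intro h
    exact ⟨c, hc, d, hd, rfl, rfl, h⟩

lemma isStrictTotalOrder_lexLT {u w : Perm (Fin n)} (h : KBruhatLE k u w) :
    IsStrictTotalOrder (facets (sigmaComplex k u w)) (fun F G => LexLT k u w F.1 G.1) where
  trichotomous := by
    rintro ⟨F, hF⟩ ⟨G, hG⟩ h1 h2
    obtain ⟨c, hc, rfl⟩ := (mem_facets_iff h).1 hF
    obtain ⟨d, hd, rfl⟩ := (mem_facets_iff h).1 hG
    rw [lexLT_chainImage_iff hc hd] at h1
    rw [lexLT_chainImage_iff hd hc] at h2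
    simp only [lex_reflections_trichotomous hc hd h1 h2]
  irrefl := by
    rintro ⟨F, hF⟩ h1
    obtain ⟨c, hc, rfl⟩ := (mem_facets_iff h).1 hF
    rw [lexLT_chainImage_iff hc hc] at h1
    exact List.lex_irrefl (reflLT_irrefl w) _ h1
  trans := by
    rintro ⟨F, hF⟩ ⟨G, hG⟩ ⟨H, hH⟩ h1 h2
    obtain ⟨c, hc, rfl⟩ := (mem_facets_iff h).1 hF
    obtain ⟨d, hd, rfl⟩ := (mem_facets_iff h).1 hG
    obtain ⟨e, he, rfl⟩ := (mem_facets_iff h).1 hH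
    rw [lexLT_chainImage_iff hc hd] at h1
    rw [lexLT_chainImage_iff hd he] at h2
    exact (lexLT_chainImage_iff hc he).2 (List.lex_trans ReflLT.trans h1 h2)

lemma isShellingOrder_lexLT {u w : Perm (Fin n)} (h : KBruhatLE k u w) :
    IsShellingOrder (sigmaComplex k u w) (LexLT k u w) where
  finite := Set.toFinite _
  total := isStrictTotalOrder_lexLT h
  pure := by
    refine ⟨length w + 1 - length u, fun F hF => ?_, fun F hF G hG => ?_⟩
    · obtain ⟨c, hc, rfl⟩ := (mem_facets_iff h).1 hF
      have := card_chainImage hc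
      omega
    · obtain ⟨c, hc, rfl⟩ := (mem_facets_iff h).1 hF
      obtain ⟨⟨hGF, F', hF', hlt, hGF'⟩, hmax⟩ := hG
      obtain ⟨d, hd, rfl⟩ := (mem_facets_iff h).1 hF'
      obtain ⟨S, hS, hSd, e, he, hlex, hsub⟩ :=
        exists_exchange hc hd ((lexLT_chainImage_iff hd hc).1 hlt)
      have hGS : G ⊆ (chainImage k c).erase S := fun T hT =>
        Finset.mem_erase.2 ⟨fun hTS => hSd (hTS ▸ hGF' hT), hGF hT⟩
      have hG : G = (chainImage k c).erase S :=
        le_antisymm hGS (hmax ⟨Finset.erase_subset _ _, _, (mem_facets_iff h).2 ⟨e, he, rfl⟩,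
          (lexLT_chainImage_iff he hc).2 hlex, hsub⟩ hGS)
      have h1 := card_chainImage hc
      have h2 := Finset.card_erase_add_one hS
      rw [hG]
      omega

end KBruhat

theorem theoremT (n k : ℕ) (hk : k ≤ n) (u w : Equiv.Perm (Fin n))
    (huw : KBruhat.KBruhatLE k u w) :
    Set.BijOn (KBruhat.chainImage k) (KBruhat.maxKChains k u w)
        (KBruhat.facets (KBruhat.sigmaComplex k u w)) ∧
      KBruhat.IsShellingOrder (KBruhat.sigmaComplex k u w) (KBruhat.LexLT k u w) ∧
      KBruhat.IsShellable (KBruhat.sigmaComplex k u w) :=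
  ⟨⟨fun c hc => (KBruhat.mem_facets_iff huw).2 ⟨c, hc, rfl⟩, KBruhat.chainImage_injOn u w,
      fun _ hF => (KBruhat.mem_facets_iff huw).1 hF⟩,
    KBruhat.isShellingOrder_lexLT huw, _, KBruhat.isShellingOrder_lexLT huw⟩
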